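/- **Channel.** Let $\alpha,\sigma_R,P_S>0$. When the source sends $x_S$ and the relay sends $x_R$, the relay receives $Y_R=x_S+I+N_R$. Here $N_R\sim\mathcal N(0,\sigma_R^2)$ is noise and $I=G\,x_R$ with $G\sim\mathcal N(0,\alpha)$ is residual self-interference (so $I\sim\mathcal N(0,\alpha x_R^2)$). All noises and gains are independent across symbol intervals and slots. Let $p$ be any probability distribution on $\mathbb R$ for the relay's symbols (in particular the optimal one, $p^*$). Let $x_{\rm th}>0$ satisfy $\int P_S(x_R)\,dp(x_R)=P_S$, where $P_S(x_R)=\alpha\max\{0,x_{\rm th}^2-x_R^2\}$. Put $p_T=\Pr\{|X_R|<x_{\rm th}\}$ for $X_R\sim p$. **Scheme.** Fix $R\in\mathbb R$ and $B\in\mathbb N$. Slots have $k$ symbol intervals. The messages $w(1),\dots,w(B)$ are independent and uniform on a set of $\lceil 2^{kR}\rceil$ elements. The source codebook has one codeword of $\lfloor kp_T\rfloor$ i.i.d. $\mathcal N(0,1)$ symbols per message. The relay codebook has one codeword of $k$ i.i.d. symbols of law $p$ per message. The messages, the two codebooks, the gains and the noises are independent, and the same codebooks are used in all slots. In slot $b\in\{2,\dots,B\}$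 the relay sends its codeword $\mathbf x_R(b)$ for $w(b-1)$. In each interval $j$ with $|x_{R,j}|<x_{\rm th}$ the source sends the next untransmitted symbol of its codeword $\mathbf x_S(b)$ for $w(b)$, multiplied by $\sqrt{P_S(x_{R,j})}$. In the other intervals, and once its codeword is exhausted, it is silent. The relay keeps only the received symbols of the intervals with $|x_{R,j}|<x_{\rm th}$. Let $T$ be their number and $m=\min\{\lfloor kp_T\rfloor,T\}$. The relay decodes $w(b)$ (that is, $\mathbf x_S(b)$) as the unique message whose codeword's first $m$ symbols are jointly $\varepsilon$-typical with the first $m$ kept received symbols, given the corresponding relay symbols. If there is no such message or more than one, it declares an error. Joint $\varepsilon$-typicality means the following. Let $X\sim\mathcal N(0,1)$, let $S$ be independent of $X$ with the law $p$ conditioned on $|S|<x_{\rm th}$, and let $Y$ be the channel output for source input $\sqrt{P_S(S)}\,X$ and relay input $S$. Then $-\frac1m\log_2$ of the densities of $\mathbf x$, of $\mathbf y$ given $\mathbf s$, and of $(\mathbf x,\mathbf y)$ given $\mathbf s$ are within $\varepsilon$ of $h(X)$, $h(Y|S)$ and $h(X,Y|S)$, respectively. **Claim.** (i) For every $x_R\in\mathbb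 R$, $$\max_{p(x_S|x_R):\,E[X_S^2|X_R=x_R]\le P_S(x_R)} I(X_S;Y_R|X_R=x_R)=\frac12\log_2\Bigl(1+\frac{\alpha\max\{0,x_{\rm th}^2-x_R^2\}}{\sigma_R^2+\alpha x_R^2}\Bigr),$$ and hence the averages of both sides with respect to $p$ agree. (ii) If $$R<\int\frac12\log_2\Bigl(1+\frac{\alpha\max\{0,x_{\rm th}^2-x_R^2\}}{\sigma_R^2+\alpha x_R^2}\Bigr)dp(x_R)$$ (for discrete $p$ this is $\sum_{x_R}\frac12\log_2(\cdot)\,p(x_R)$), then for all sufficiently small $\varepsilon>0$ and all $B$, the probability that the relay decodes wrongly in at least one of the slots $b=2,\dots,B$ tends to $0$ as $k\to\infty$. -/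

import Mathlib

open MeasureTheory ProbabilityTheory Filter Topology
open scoped ENNReal NNReal

noncomputable section

namespace FDRelay

/-! ### The source-relay channel and the power allocation -/

/-- Normalized received symbol at the relay, `Y_R = X_S + I + N_R`, where the residual
self-interference is `I = g * x_R`; here `g` is the normalized random self-interference gain and
`z` is the receiver noise. -/
def relayOutput (xS xR g z : ℝ) : ℝ := xS + g * xR + z

/-- Law of the self-interference gain: `N(0, α)`. -/
def gainLaw (α : ℝ) : Measure ℝ := gaussianReal 0 α.toNNReal

/-- Law of the receiver noise at the relay: `N(0, σ²)`. -/
def noiseLaw (σ : ℝ) : Measure ℝ := gaussianReal 0 (σ ^ 2).toNNReal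

/-- Variance of self-interference plus noise when the relay transmits `x`. -/
def noiseVar (α σ x : ℝ) : ℝ := σ ^ 2 + α * x ^ 2

/-- The source's power allocation `P_S(x_R) = α max{0, x_th² - x_R²}`. -/
def srcPower (α xth x : ℝ) : ℝ := α * max 0 (xth ^ 2 - x ^ 2)

/-- `½ log₂ (1 + α max{0, x_th² - x_R²} / (σ_R² + α x_R²))`. -/
def stateRate (α σ xth x : ℝ) : ℝ :=
  1 / 2 * Real.logb 2 (1 + α * max 0 (xth ^ 2 - x ^ 2) / (σ ^ 2 + α * x ^ 2))

/-- Joint law of `(X_S, Y_R)` given `X_R = x`, when `X_S` has law `μ`. -/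
def channelJoint (α σ x : ℝ) (μ : Measure ℝ) : Measure (ℝ × ℝ) :=
  (μ.prod ((gainLaw α).prod (noiseLaw σ))).map
    (fun ω => (ω.1, relayOutput ω.1 x ω.2.1 ω.2.2))

/-- Mutual information (in bits) of the two coordinates of a joint law: the relative entropy of the
joint law with respect to the product of its marginals. -/
def mutualInfo (J : Measure (ℝ × ℝ)) : ℝ≥0∞ :=
  InformationTheory.klDiv J (J.fst.prod J.snd) / ENNReal.ofReal (Real.log 2)

/-- All values of `I(X_S; Y_R | X_R = x)` (in bits) over the input laws whose average power is at
most `P_S(x)`. -/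
def infoValues (α σ xth x : ℝ) : Set ℝ≥0∞ :=
  {I | ∃ μ : Measure ℝ, IsProbabilityMeasure μ ∧
    ∫⁻ u, ENNReal.ofReal (u ^ 2) ∂μ ≤ ENNReal.ofReal (srcPower α xth x) ∧
    I = mutualInfo (channelJoint α σ x μ)}

/-! ### Positions in which the source transmits -/

/-- The positions of a relay codeword whose symbol has amplitude smaller than `x_th`. -/
def active (xth : ℝ) {k : ℕ} (xR : Fin k → ℝ) : Finset (Fin k) :=
  Finset.univ.filter (fun j => |xR j| < xth)

/-- The number of active positions. -/
abbrev numActive (xth : ℝ) {k : ℕ} (xR : Fin k → ℝ) : ℕ := (active xth xR).card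

/-- The `r`-th active position, in increasing order. -/
def activePos (xth : ℝ) {k : ℕ} (xR : Fin k → ℝ) (r : Fin (numActive xth xR)) : Fin k :=
  (active xth xR).orderEmbOfFin rfl r

/-- The number of active positions strictly before `j`. -/
def activeRank (xth : ℝ) {k : ℕ} (xR : Fin k → ℝ) (j : Fin k) : ℕ :=
  ((active xth xR).filter (fun i => i < j)).card

/-- The symbols sent by the source in one slot. In each active position it sends its next
untransmitted codeword symbol, amplified by `√(P_S(x_R))`; in the other positions, and once the
codeword is exhausted, it is silent. -/
def sourceInput (α xth : ℝ) {n k : ℕ} (xS : Fin n → ℝ) (xR : Fin k → ℝ) (j : Fin k) : ℝ :=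
  if |xR j| < xth then
    if h : activeRank xth xR j < n then
      √(srcPower α xth (xR j)) * xS ⟨activeRank xth xR j, h⟩
    else 0
  else 0

/-- The symbols received by the relay in one slot. -/
def slotOutput (α xth : ℝ) {n k : ℕ} (xS : Fin n → ℝ) (xR g z : Fin k → ℝ) (j : Fin k) : ℝ :=
  relayOutput (sourceInput α xth xS xR j) (xR j) (g j) (z j)

/-- The received symbols kept by the relay: those in the active positions, in order. -/
def collect (xth : ℝ) {k : ℕ} (xR y : Fin k → ℝ) (r : Fin (numActive xth xR)) : ℝ :=
  y (activePos xth xR r)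

/-! ### The jointly typical decoder -/

/-- Density of a source codeword symbol. -/
def densX (x : ℝ) : ℝ := gaussianPDFReal 0 1 x

/-- Density of the received symbol, given the relay symbol `s`. -/
def densY (α σ xth s y : ℝ) : ℝ :=
  gaussianPDFReal 0 (srcPower α xth s + noiseVar α σ s).toNNReal y

/-- Joint density of the source codeword symbol and the received symbol, given the relay
symbol `s`. -/
def densXY (α σ xth s x y : ℝ) : ℝ :=
  densX x * gaussianPDFReal (√(srcPower α xth s) * x) (noiseVar α σ s).toNNReal y

/-- Law of a relay symbol conditioned on `|x_R| < x_th`. -/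
def activeLaw (xth : ℝ) (p : Measure ℝ) : Measure ℝ := ProbabilityTheory.cond p {x | |x| < xth}

/-- Differential entropy `h(X)` in bits. -/
def entX : ℝ := -∫ x, densX x * Real.logb 2 (densX x)

/-- Conditional differential entropy `h(Y | S)` in bits. -/
def entY (α σ xth : ℝ) (p : Measure ℝ) : ℝ :=
  -∫ s, (∫ y, densY α σ xth s y * Real.logb 2 (densY α σ xth s y)) ∂(activeLaw xth p)

/-- Conditional joint differential entropy `h(X, Y | S)` in bits. -/
def entXY (α σ xth : ℝ) (p : Measure ℝ) : ℝ :=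
  -∫ s, (∫ u : ℝ × ℝ, densXY α σ xth s u.1 u.2 * Real.logb 2 (densXY α σ xth s u.1 u.2))
    ∂(activeLaw xth p)

/-- `x` and `y` are jointly `ε`-typical, given the relay symbols `s`: the three empirical entropies
are within `ε` of the true ones. -/
def JointlyTypical (α σ xth : ℝ) (p : Measure ℝ) (ε : ℝ) {m : ℕ} (s x y : Fin m → ℝ) : Prop :=
  |-(1 / (m : ℝ)) * ∑ r, Real.logb 2 (densX (x r)) - entX| < ε ∧
  |-(1 / (m : ℝ)) * ∑ r, Real.logb 2 (densY α σ xth (s r) (y r)) - entY α σ xth p| < ε ∧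
  |-(1 / (m : ℝ)) * ∑ r, Real.logb 2 (densXY α σ xth (s r) (x r) (y r)) - entXY α σ xth p| < ε

/-- Joint typicality of the source codeword `xS` with the collected received symbols `yR`, over the
codeword symbols that were transmitted (the first `min n T`, where `T` is the number of active
positions of `xR`). -/
def TypicalWith (α σ xth : ℝ) (p : Measure ℝ) (ε : ℝ) {n k : ℕ} (xR : Fin k → ℝ)
    (yR : Fin (numActive xth xR) → ℝ) (xS : Fin n → ℝ) : Prop :=
  JointlyTypical α σ xth p ε (m := min n (numActive xth xR))
    (fun r => xR (activePos xth xR (r.castLE (min_le_right _ _))))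
    (fun r => xS (r.castLE (min_le_left _ _)))
    (fun r => yR (r.castLE (min_le_right _ _)))

open Classical in
/-- The jointly typical decoder: it outputs the only message whose codeword is jointly typical with
the collected received symbols, and `none` if there is no such message or more than one. -/
def relayDecode (α σ xth : ℝ) (p : Measure ℝ) (ε : ℝ) {M n k : ℕ} (cS : Fin M → Fin n → ℝ)
    (xR : Fin k → ℝ) (yR : Fin (numActive xth xR) → ℝ) : Option (Fin M) :=
  if h : ∃! w, TypicalWith α σ xth p ε xR yR (cS w) then some h.exists.choose else none

/-! ### The block-Markov scheme -/

/-- Everything random in the scheme with `B` messages. -/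
structure Sample (B M n k : ℕ) where
  /-- `msg ⟨b - 1, _⟩` is the message `w(b)` -/
  msg : Fin B → Fin M
  /-- the source's codebook -/
  cS : Fin M → Fin n → ℝ
  /-- the relay's codebook -/
  cR : Fin M → Fin k → ℝ
  /-- `gain ⟨b - 1, _⟩ j` is the self-interference gain in symbol interval `j` of slot `b` -/
  gain : Fin B → Fin k → ℝ
  /-- `noise ⟨b - 1, _⟩ j` is the noise at the relay in symbol interval `j` of slot `b` -/
  noise : Fin B → Fin k → ℝ

/-- All coordinates are independent: uniform messages, source codebook i.i.d. `N(0, 1)`, relay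
codebook i.i.d. `p`, gains i.i.d. `N(0, α)` and noises i.i.d. `N(0, σ²)`. -/
def schemeLaw (α σ : ℝ) (p : Measure ℝ) (B M n k : ℕ) :
    Measure ((Fin B → Fin M) × (Fin M → Fin n → ℝ) × (Fin M → Fin k → ℝ) ×
      (Fin B → Fin k → ℝ) × (Fin B → Fin k → ℝ)) :=
  (Measure.pi fun _ => uniformOn Set.univ).prod
    ((Measure.pi fun _ => Measure.pi fun _ => gaussianReal 0 1).prod
      ((Measure.pi fun _ => Measure.pi fun _ => p).prod
        ((Measure.pi fun _ => Measure.pi fun _ => gainLaw α).prod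
          (Measure.pi fun _ => Measure.pi fun _ => noiseLaw σ))))

/-- The relay's decision on `w(b)` in a slot `b`, where the slot has index `i`, the relay sends
codeword `cR wPrev` and the source sends codeword `cS (msg i)`. -/
def slotDecision (α σ xth : ℝ) (p : Measure ℝ) (ε : ℝ) {B M n k : ℕ} (ω : Sample B M n k)
    (wPrev : Fin M) (i : Fin B) : Option (Fin M) :=
  relayDecode α σ xth p ε ω.cS (ω.cR wPrev)
    (collect xth (ω.cR wPrev)
      (slotOutput α xth (ω.cS (ω.msg i)) (ω.cR wPrev) (ω.gain i) (ω.noise i)))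

/-- In at least one of the slots `b = 2, …, B` the relay fails to decode `w(b)`. -/
def RelayError (α σ xth : ℝ) (p : Measure ℝ) (ε : ℝ) {B M n k : ℕ} (ω : Sample B M n k) : Prop :=
  ∃ (b : ℕ) (h2 : 2 ≤ b) (hB : b ≤ B),
    slotDecision α σ xth p ε ω (ω.msg ⟨b - 2, by omega⟩) ⟨b - 1, by omega⟩ ≠
      some (ω.msg ⟨b - 1, by omega⟩)

/-- The probability `p_T` that a relay symbol has amplitude smaller than `x_th`. -/
def activeProb (xth : ℝ) (p : Measure ℝ) : ℝ := p.real {x | |x| < xth}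

/-- The number `2^{kR}` of messages (rounded up). -/
def numMessages (R : ℝ) (k : ℕ) : ℕ := ⌈(2 : ℝ) ^ ((k : ℝ) * R)⌉₊

/-- The length `k p_T` of the source codewords (rounded down). -/
def codewordLength (xth : ℝ) (p : Measure ℝ) (k : ℕ) : ℕ := ⌊(k : ℝ) * activeProb xth p⌋₊

/-- The probability, over messages, codebooks, self-interference and noise, that the relay makes a
decoding error in at least one of the slots `2, …, B`, each comprised of `k` symbol intervals. -/
def errorProb (α σ xth : ℝ) (p : Measure ℝ) (R ε : ℝ) (B k : ℕ) : ℝ≥0∞ :=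
  schemeLaw α σ p B (numMessages R k) (codewordLength xth p k) k
    {ω | RelayError α σ xth p ε ⟨ω.1, ω.2.1, ω.2.2.1, ω.2.2.2.1, ω.2.2.2.2⟩}

end FDRelay

end

/-!
Part (i). For a fixed relay symbol the channel adds Gaussian noise of variance `N = σ² + α x²`. The
information between input and output is `E log φ_N(Y - X) - E log f(Y)`, where `φ_N` is the noise
density and `f` the output density. The first term does not depend on the input law. Gibbs'
inequality compares `f` with the Gaussian density of variance `P + N`, and turns the power
constraint into the bound `½ log (1 + P / N)`; a Gaussian input makes `f` equal to that density
(`klDiv_awgnJoint_le`, `klDiv_awgnJoint_gaussianReal`).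

Part (ii). The power allocation is a water filling: in every active position the received power is
the same number `V = α x_th² + σ²` (`srcPower_add_noiseVar`). Given the relay codeword, the three
empirical entropies of the transmitted codeword are therefore affine functions of sums of squares of
independent standard Gaussian variables, up to the empirical mean of `½ log₂ N(s)` over the relay
symbols. Chebyshev's inequality controls the former (`measure_not_jointlyTypical_le`), and the
latter holds for all relay codewords outside a set of vanishing probability
(`measure_compl_goodRelay_le`, `bounds_of_mem_goodRelay`). These relay codewords also have `k p_T`
active positions up to a small fraction of `k`, so that `m`, the number of transmitted symbols, is
close to `k p_T`.

For an independent codeword, joint typicality forces the likelihood ratio of the joint density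
against the product density to be at least `2 ^ (m (I - 3 ε))`, with `I = I(X; Y | S)`. This ratio
is a posterior density divided by the prior, so it has mean one for *every* received sequence, and
Markov's inequality bounds the probability (`measure_jointlyTypical_indep_le`). A union bound over
fewer than `2 ^ (k R)` other messages and over the slots finishes the proof, because `p_T I` is the
integral of the rate function (`integral_stateRate_eq`).

All error events are bounded for fixed messages, which are then averaged out; so nothing is needed
about the dependence between slots.
-/

noncomputable section

namespace FDRelay

/-! ### Gaussian laws and densities -/

lemma noiseVar_pos {α σ : ℝ} (hα : 0 < α) (hσ : 0 < σ) (x : ℝ) : 0 < noiseVar α σ x := by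
  unfold noiseVar; positivity

lemma srcPower_nonneg {α : ℝ} (hα : 0 < α) (xth x : ℝ) : 0 ≤ srcPower α xth x :=
  mul_nonneg hα.le (le_max_left _ _)

instance (α : ℝ) : IsProbabilityMeasure (gainLaw α) := by unfold gainLaw; infer_instance

instance (σ : ℝ) : IsProbabilityMeasure (noiseLaw σ) := by unfold noiseLaw; infer_instance

lemma gaussianReal_prod_map_linear (a b : ℝ) (v w : ℝ≥0) :
    ((gaussianReal 0 v).prod (gaussianReal 0 w)).map (fun q => a * q.1 + b * q.2) =
      gaussianReal 0 (a ^ 2 * v + b ^ 2 * w : ℝ).toNNReal := by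
  have h : (fun q : ℝ × ℝ => a * q.1 + b * q.2) =
      (fun q : ℝ × ℝ => q.1 + q.2) ∘ Prod.map (fun x => a * x) (fun x => b * x) := rfl
  rw [h, ← Measure.map_map (by fun_prop) (by fun_prop),
    ← Measure.map_prod_map _ _ (by fun_prop) (by fun_prop), gaussianReal_map_const_mul,
    gaussianReal_map_const_mul]
  refine Eq.trans gaussianReal_conv_gaussianReal ?_
  congr 1
  · simp
  · rw [← NNReal.coe_inj]
    push_cast
    rw [Real.coe_toNNReal _ (by positivity)]

lemma map_interference_noise {α σ : ℝ} (hα : 0 < α) (x : ℝ) :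
    ((gainLaw α).prod (noiseLaw σ)).map (fun q => q.1 * x + q.2) =
      gaussianReal 0 (noiseVar α σ x).toNNReal := by
  have := gaussianReal_prod_map_linear x 1 α.toNNReal (σ ^ 2).toNNReal
  rw [Real.coe_toNNReal _ hα.le, Real.coe_toNNReal _ (sq_nonneg σ)] at this
  rw [gainLaw, noiseLaw]
  convert this using 3
  · ring
  · rw [noiseVar]; ring

lemma log_gaussianPDFReal (μ : ℝ) {v : ℝ≥0} (hv : v ≠ 0) (x : ℝ) :
    Real.log (gaussianPDFReal μ v x) =
      -(Real.log (2 * Real.pi * v) / 2) - (x - μ) ^ 2 / (2 * v) := by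
  have h : (0 : ℝ) < v := lt_of_le_of_ne v.2 (fun h => hv (NNReal.coe_eq_zero.1 h.symm))
  rw [gaussianPDFReal, Real.log_mul (by positivity) (Real.exp_ne_zero _), Real.log_exp,
    Real.log_inv, Real.log_sqrt (by positivity)]
  ring

lemma integrable_sq_gaussianReal (m : ℝ) (v : ℝ≥0) :
    Integrable (fun x => x ^ 2) (gaussianReal m v) :=
  (memLp_id_gaussianReal 2).integrable_sq

lemma integral_sq_gaussianReal (v : ℝ≥0) : ∫ x, x ^ 2 ∂(gaussianReal 0 v) = v := by
  have h := variance_fun_id_gaussianReal (μ := 0) (v := v)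
  rw [variance_eq_integral measurable_id'.aemeasurable] at h
  simpa [integral_id_gaussianReal] using h

/-- A Gaussian prior with variance `P` and a Gaussian likelihood with variance `N` factor into the
Gaussian evidence with variance `P + N` and a Gaussian posterior. The prior is standard here, and
its amplitude `a` is part of the likelihood. -/
lemma gaussianPDFReal_mul_eq_evidence_mul_posterior (a : ℝ) {N : ℝ} (hN : 0 < N) (x y : ℝ) :
    gaussianPDFReal 0 1 x * gaussianPDFReal (a * x) N.toNNReal y =
      gaussianPDFReal 0 (a ^ 2 + N).toNNReal y *
        gaussianPDFReal (a * y / (a ^ 2 + N)) (N / (a ^ 2 + N)).toNNReal x := by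
  have hV : 0 < a ^ 2 + N := by positivity
  have hp : 0 < Real.pi := Real.pi_pos
  simp only [gaussianPDFReal]
  rw [Real.coe_toNNReal _ hN.le, Real.coe_toNNReal _ hV.le,
    Real.coe_toNNReal _ (by positivity)]
  conv_lhs => rw [mul_mul_mul_comm, ← Real.exp_add, ← mul_inv, ← Real.sqrt_mul (by positivity)]
  conv_rhs => rw [mul_mul_mul_comm, ← Real.exp_add, ← mul_inv, ← Real.sqrt_mul (by positivity)]
  congr 1
  · congr 2
    push_cast
    field_simp
  · congr 1
    push_cast
    field_simp
    ring

/-! ### The additive Gaussian channel: joint law, output law and mutual information -/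

/-- Joint law of the input `X` and the output `X + Z` of the channel with additive noise
`Z ∼ N(0, N)`, when `X` has law `μ`. -/
def awgnJoint (μ : Measure ℝ) (N : ℝ≥0) : Measure (ℝ × ℝ) :=
  (μ.prod (gaussianReal 0 N)).map (fun q => (q.1, q.1 + q.2))

/-- Density of the output of the additive Gaussian noise channel with input law `μ`. -/
def awgnDensity (μ : Measure ℝ) (N : ℝ≥0) (y : ℝ) : ℝ≥0∞ := ∫⁻ u, gaussianPDF u N y ∂μ

lemma channelJoint_eq_awgnJoint {α σ : ℝ} (hα : 0 < α) (x : ℝ) (μ : Measure ℝ)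
    [IsProbabilityMeasure μ] :
    channelJoint α σ x μ = awgnJoint μ (noiseVar α σ x).toNNReal := by
  have h : (fun ω : ℝ × ℝ × ℝ => (ω.1, relayOutput ω.1 x ω.2.1 ω.2.2)) =
      (fun q : ℝ × ℝ => (q.1, q.1 + q.2)) ∘ Prod.map id (fun q : ℝ × ℝ => q.1 * x + q.2) := by
    funext ω
    simp [relayOutput, add_assoc]
  rw [channelJoint, h, ← Measure.map_map (by fun_prop) (by fun_prop),
    ← Measure.map_prod_map _ _ measurable_id (by fun_prop), map_interference_noise hα,
    Measure.map_id, awgnJoint]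

section AWGN

variable {μ : Measure ℝ} {N : ℝ≥0}

instance [IsProbabilityMeasure μ] : IsProbabilityMeasure (awgnJoint μ N) :=
  Measure.isProbabilityMeasure_map (by fun_prop)

lemma measurable_gaussianPDF_fst_snd :
    Measurable (fun q : ℝ × ℝ => gaussianPDF q.1 N q.2) :=
  measurable_uncurry_gaussianPDF.comp (by fun_prop : Measurable fun q : ℝ × ℝ => (q.1, N, q.2))

lemma awgnJoint_eq_withDensity (hN : N ≠ 0) :
    awgnJoint μ N = (μ.prod volume).withDensity (fun q => gaussianPDF q.1 N q.2) := by
  ext s hs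
  rw [awgnJoint, Measure.map_apply (by fun_prop) hs,
    Measure.prod_apply ((by fun_prop : Measurable fun q : ℝ × ℝ => (q.1, q.1 + q.2)) hs),
    withDensity_apply _ hs, ← lintegral_indicator hs,
    lintegral_prod _ ((measurable_gaussianPDF_fst_snd.indicator hs).aemeasurable)]
  refine lintegral_congr fun u => ?_
  have hsu : MeasurableSet (Prod.mk u ⁻¹' s) := measurable_prodMk_left hs
  have : Prod.mk u ⁻¹' ((fun q : ℝ × ℝ => (q.1, q.1 + q.2)) ⁻¹' s) =
      (fun v => u + v) ⁻¹' (Prod.mk u ⁻¹' s) := rfl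
  rw [this, ← Measure.map_apply (by fun_prop) hsu, gaussianReal_map_const_add, zero_add,
    gaussianReal_apply _ hN, ← lintegral_indicator hsu]
  rfl

lemma fst_awgnJoint : (awgnJoint μ N).fst = μ := by
  rw [Measure.fst, awgnJoint, Measure.map_map measurable_fst (by fun_prop)]
  exact Measure.fst_prod

lemma measurable_awgnDensity [IsProbabilityMeasure μ] : Measurable (awgnDensity μ N) :=
  Measurable.lintegral_prod_left' measurable_gaussianPDF_fst_snd

lemma snd_awgnJoint [IsProbabilityMeasure μ] (hN : N ≠ 0) :
    (awgnJoint μ N).snd = volume.withDensity (awgnDensity μ N) := by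
  ext s hs
  rw [Measure.snd_apply hs, awgnJoint_eq_withDensity hN,
    withDensity_apply _ (measurable_snd hs), withDensity_apply _ hs, ← Set.univ_prod,
    ← Measure.prod_restrict, lintegral_prod_symm _ measurable_gaussianPDF_fst_snd.aemeasurable,
    Measure.restrict_univ]
  rfl

lemma gaussianPDFReal_le (m : ℝ) (v : ℝ≥0) (x : ℝ) :
    gaussianPDFReal m v x ≤ (√(2 * Real.pi * v))⁻¹ := by
  rw [gaussianPDFReal]
  refine mul_le_of_le_one_right (by positivity) (Real.exp_le_one_iff.2 ?_)
  exact div_nonpos_of_nonpos_of_nonneg (neg_nonpos.2 (sq_nonneg _)) (by positivity)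

lemma awgnDensity_le [IsProbabilityMeasure μ] (y : ℝ) :
    awgnDensity μ N y ≤ ENNReal.ofReal (√(2 * Real.pi * N))⁻¹ := by
  refine (lintegral_mono fun u => ENNReal.ofReal_le_ofReal (gaussianPDFReal_le u N y)).trans ?_
  simp

lemma awgnDensity_ne_top [IsProbabilityMeasure μ] (y : ℝ) : awgnDensity μ N y ≠ ∞ :=
  ((awgnDensity_le y).trans_lt ENNReal.ofReal_lt_top).ne

lemma awgnDensity_ne_zero [IsProbabilityMeasure μ] (hN : N ≠ 0) (y : ℝ) :
    awgnDensity μ N y ≠ 0 := by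
  have hm : Measurable fun u => gaussianPDF u N y := by
    unfold gaussianPDF gaussianPDFReal
    fun_prop
  rw [awgnDensity, Ne, lintegral_eq_zero_iff hm]
  intro h
  obtain ⟨u, hu⟩ := h.exists
  exact (gaussianPDF_pos u hN y).ne' hu

lemma awgnJoint_eq_withDensity_prod [IsProbabilityMeasure μ] (hN : N ≠ 0) :
    awgnJoint μ N = ((awgnJoint μ N).fst.prod (awgnJoint μ N).snd).withDensity
      (fun q => gaussianPDF q.1 N q.2 / awgnDensity μ N q.2) := by
  have hf : Measurable fun q : ℝ × ℝ => awgnDensity μ N q.2 :=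
    measurable_awgnDensity.comp measurable_snd
  have hm : Measurable fun q : ℝ × ℝ => gaussianPDF q.1 N q.2 / awgnDensity μ N q.2 :=
    measurable_gaussianPDF_fst_snd.div hf
  rw [fst_awgnJoint, snd_awgnJoint hN, prod_withDensity_right measurable_awgnDensity,
    ← withDensity_mul _ hf hm]
  conv_lhs => rw [awgnJoint_eq_withDensity hN]
  congr 1
  funext q
  exact (ENNReal.mul_div_cancel (awgnDensity_ne_zero hN _) (awgnDensity_ne_top _)).symm

lemma awgnJoint_absolutelyContinuous [IsProbabilityMeasure μ] (hN : N ≠ 0) :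
    awgnJoint μ N ≪ (awgnJoint μ N).fst.prod (awgnJoint μ N).snd := by
  conv_lhs => rw [awgnJoint_eq_withDensity_prod hN]
  exact withDensity_absolutelyContinuous _ _

lemma llr_awgnJoint [IsProbabilityMeasure μ] (hN : N ≠ 0) :
    llr (awgnJoint μ N) ((awgnJoint μ N).fst.prod (awgnJoint μ N).snd) =ᵐ[awgnJoint μ N]
      fun q => Real.log (gaussianPDFReal q.1 N q.2) - Real.log (awgnDensity μ N q.2).toReal := by
  have hm : Measurable fun q : ℝ × ℝ => gaussianPDF q.1 N q.2 / awgnDensity μ N q.2 :=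
    measurable_gaussianPDF_fst_snd.div (measurable_awgnDensity.comp measurable_snd)
  have h := Measure.rnDeriv_withDensity ((awgnJoint μ N).fst.prod (awgnJoint μ N).snd) hm
  rw [← awgnJoint_eq_withDensity_prod hN] at h
  filter_upwards [awgnJoint_absolutelyContinuous hN h] with q hq
  rw [llr, hq, ENNReal.toReal_div, toReal_gaussianPDF, Real.log_div]
  · exact (gaussianPDFReal_pos _ _ _ hN).ne'
  · exact (ENNReal.toReal_pos (awgnDensity_ne_zero hN _) (awgnDensity_ne_top _)).ne'

lemma hasIntegral_log_likelihood [IsProbabilityMeasure μ] (hN : N ≠ 0) :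
    Integrable (fun q : ℝ × ℝ => Real.log (gaussianPDFReal q.1 N q.2)) (awgnJoint μ N) ∧
      ∫ q, Real.log (gaussianPDFReal q.1 N q.2) ∂(awgnJoint μ N) =
        -(Real.log (2 * Real.pi * N) / 2) - 1 / 2 := by
  have hN' : (N : ℝ) ≠ 0 := NNReal.coe_ne_zero.2 hN
  have hT : Measurable fun q : ℝ × ℝ => (q.1, q.1 + q.2) := by fun_prop
  have hm : AEStronglyMeasurable (fun q : ℝ × ℝ => Real.log (gaussianPDFReal q.1 N q.2))
      (awgnJoint μ N) := by
    refine (Measurable.log ?_).aestronglyMeasurable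
    exact measurable_uncurry_gaussianPDFReal.comp
      (by fun_prop : Measurable fun q : ℝ × ℝ => (q.1, N, q.2))
  have hcomp : ∀ q : ℝ × ℝ, Real.log (gaussianPDFReal q.1 N (q.1 + q.2)) =
      -(Real.log (2 * Real.pi * N) / 2) - q.2 ^ 2 / (2 * N) := by
    intro q
    rw [log_gaussianPDFReal _ hN, add_sub_cancel_left]
  have hi : Integrable (fun q : ℝ × ℝ => q.2 ^ 2 / (2 * (N : ℝ)))
      (μ.prod (gaussianReal 0 N)) :=
    ((integrable_sq_gaussianReal 0 N).comp_snd μ).div_const _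
  constructor
  · rw [awgnJoint] at hm ⊢
    rw [integrable_map_measure hm hT.aemeasurable]
    simp only [Function.comp_def, hcomp]
    exact (integrable_const _).sub hi
  · rw [awgnJoint] at hm ⊢
    rw [integral_map hT.aemeasurable hm]
    simp only [hcomp]
    rw [integral_sub (integrable_const _) hi, integral_div,
      integral_fun_snd (fun v : ℝ => v ^ 2), integral_sq_gaussianReal]
    simp
    field_simp

lemma hasIntegral_sq_output [IsProbabilityMeasure μ] (hμ : Integrable (fun u => u ^ 2) μ) :
    Integrable (fun y => y ^ 2) (awgnJoint μ N).snd ∧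
      ∫ y, y ^ 2 ∂(awgnJoint μ N).snd = ∫ u, u ^ 2 ∂μ + N := by
  have hT : Measurable fun q : ℝ × ℝ => q.1 + q.2 := by fun_prop
  have hsnd : (awgnJoint μ N).snd = (μ.prod (gaussianReal 0 N)).map fun q => q.1 + q.2 := by
    rw [Measure.snd, awgnJoint, Measure.map_map measurable_snd (by fun_prop)]
    rfl
  have hm : ∀ ν : Measure ℝ, AEStronglyMeasurable (fun y : ℝ => y ^ 2) ν :=
    fun ν => (by fun_prop : Measurable fun y : ℝ => y ^ 2).aestronglyMeasurable
  have h1 : Integrable (fun q : ℝ × ℝ => q.1 ^ 2) (μ.prod (gaussianReal 0 N)) := hμ.comp_fst _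
  have h2 : Integrable (fun q : ℝ × ℝ => q.2 ^ 2) (μ.prod (gaussianReal 0 N)) :=
    (integrable_sq_gaussianReal 0 N).comp_snd _
  have hu : Integrable (fun u : ℝ => u) μ :=
    ((memLp_two_iff_integrable_sq measurable_id'.aestronglyMeasurable).2 hμ).integrable
      one_le_two
  have hv : Integrable (fun v : ℝ => v) (gaussianReal 0 N) :=
    (memLp_id_gaussianReal 1).integrable le_rfl
  have h3 : Integrable (fun q : ℝ × ℝ => q.1 * q.2) (μ.prod (gaussianReal 0 N)) :=
    hu.mul_prod hv
  have he : ∀ q : ℝ × ℝ, (q.1 + q.2) ^ 2 = q.1 ^ 2 + (2 * (q.1 * q.2) + q.2 ^ 2) := by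
    intro q; ring
  constructor
  · rw [hsnd, integrable_map_measure (hm _) hT.aemeasurable]
    simp only [Function.comp_def, he]
    exact h1.add ((h3.const_mul 2).add h2)
  · rw [hsnd, integral_map hT.aemeasurable (hm _)]
    simp only [he]
    have h4 : Integrable (fun q : ℝ × ℝ => 2 * (q.1 * q.2) + q.2 ^ 2)
        (μ.prod (gaussianReal 0 N)) := (h3.const_mul 2).add h2
    rw [integral_add h1 h4, integral_add (h3.const_mul 2) h2,
      integral_const_mul, integral_prod_mul (fun u : ℝ => u) (fun v : ℝ => v),
      integral_id_gaussianReal, integral_fun_snd (fun v : ℝ => v ^ 2), integral_sq_gaussianReal,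
      integral_fun_fst (fun v : ℝ => v ^ 2)]
    simp

/-- Gibbs' inequality for the output law of the Gaussian channel against a Gaussian density. Its
proof also shows that the logarithm of the output density, trapped between
`log g - g / f + 1` and a constant, is integrable. -/
lemma gibbs_awgnDensity [IsProbabilityMeasure μ] (hN : N ≠ 0)
    (hμ : Integrable (fun u => u ^ 2) μ) {W : ℝ≥0} (hW : W ≠ 0) :
    Integrable (fun y => Real.log (awgnDensity μ N y).toReal) (awgnJoint μ N).snd ∧
      -(Real.log (2 * Real.pi * W) / 2) - (∫ u, u ^ 2 ∂μ + N) / (2 * W) ≤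
        ∫ y, Real.log (awgnDensity μ N y).toReal ∂(awgnJoint μ N).snd := by
  set Y := (awgnJoint μ N).snd with hY
  set f : ℝ → ℝ := fun y => (awgnDensity μ N y).toReal with hf
  set g : ℝ → ℝ := gaussianPDFReal 0 W with hg
  have hfpos : ∀ y, 0 < f y := fun y =>
    ENNReal.toReal_pos (awgnDensity_ne_zero hN _) (awgnDensity_ne_top _)
  have hgpos : ∀ y, 0 < g y := fun y => gaussianPDFReal_pos 0 W y hW
  have hfm : Measurable f := measurable_awgnDensity.ennreal_toReal
  have hgm : Measurable g := measurable_gaussianPDFReal 0 W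
  have hfle : ∀ y, f y ≤ (√(2 * Real.pi * N))⁻¹ := fun y =>
    ENNReal.toReal_le_of_le_ofReal (by positivity) (awgnDensity_le y)
  have hgf : Measurable fun y => ENNReal.ofReal (g y / f y) := (hgm.div hfm).ennreal_ofReal
  have hlin : ∫⁻ y, ENNReal.ofReal (g y / f y) ∂Y = 1 := by
    rw [hY, snd_awgnJoint hN, lintegral_withDensity_eq_lintegral_mul _ measurable_awgnDensity
      hgf, ← lintegral_gaussianPDF_eq_one 0 hW]
    refine lintegral_congr fun y => ?_
    rw [Pi.mul_apply, ← ENNReal.ofReal_toReal (awgnDensity_ne_top y),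
      ← ENNReal.ofReal_mul ENNReal.toReal_nonneg, gaussianPDF]
    congr 1
    exact mul_div_cancel₀ _ (hfpos y).ne'
  have hratio : Integrable (fun y => g y / f y) Y := by
    refine ⟨(hgm.div hfm).aestronglyMeasurable, ?_⟩
    rw [hasFiniteIntegral_iff_ofReal (ae_of_all _ fun y => (div_pos (hgpos y) (hfpos y)).le),
      hlin]
    exact ENNReal.one_lt_top
  have hratio1 : ∫ y, g y / f y ∂Y = 1 := by
    rw [integral_eq_lintegral_of_nonneg_ae
      (ae_of_all _ fun y => (div_pos (hgpos y) (hfpos y)).le)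
      (hgm.div hfm).aestronglyMeasurable, hlin, ENNReal.toReal_one]
  obtain ⟨hsq, hsq'⟩ := hasIntegral_sq_output (N := N) hμ
  rw [← hY] at hsq hsq'
  have hlogg : (fun y => Real.log (g y)) =
      fun y => -(Real.log (2 * Real.pi * W) / 2) - y ^ 2 / (2 * W) := by
    funext y
    rw [hg, log_gaussianPDFReal _ hW, sub_zero]
  have hY1 : IsProbabilityMeasure Y := by rw [hY]; infer_instance
  have hgint : Integrable (fun y => Real.log (g y)) Y := by
    rw [hlogg]
    exact (integrable_const _).sub (hsq.div_const _)
  have hlow : ∀ y, Real.log (g y) - g y / f y + 1 ≤ Real.log (f y) := by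
    intro y
    have := Real.log_le_sub_one_of_pos (div_pos (hgpos y) (hfpos y))
    rw [Real.log_div (hgpos y).ne' (hfpos y).ne'] at this
    linarith
  have hfint : Integrable (fun y => Real.log (f y)) Y :=
    integrable_of_le_of_le hfm.log.aestronglyMeasurable (ae_of_all _ hlow)
      (ae_of_all _ fun y => Real.log_le_log (hfpos y) (hfle y))
      ((hgint.sub hratio).add (integrable_const 1)) (integrable_const _)
  refine ⟨hfint, ?_⟩
  calc -(Real.log (2 * Real.pi * W) / 2) - (∫ u, u ^ 2 ∂μ + N) / (2 * W)
      = ∫ y, Real.log (g y) ∂Y := by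
        rw [hlogg, integral_sub (integrable_const _) (hsq.div_const _), integral_div, hsq']
        simp
    _ = ∫ y, (Real.log (g y) - g y / f y + 1) ∂Y := by
        have h : Integrable (fun y => Real.log (g y) - g y / f y) Y := hgint.sub hratio
        rw [integral_add h (integrable_const 1), integral_sub hgint hratio,
          hratio1]
        simp
    _ ≤ ∫ y, Real.log (f y) ∂Y :=
        integral_mono ((hgint.sub hratio).add (integrable_const 1)) hfint hlow

lemma klDiv_awgnJoint [IsProbabilityMeasure μ] (hN : N ≠ 0) (hμ : Integrable (fun u => u ^ 2) μ) :
    InformationTheory.klDiv (awgnJoint μ N) ((awgnJoint μ N).fst.prod (awgnJoint μ N).snd) =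
      ENNReal.ofReal (-(Real.log (2 * Real.pi * N) / 2) - 1 / 2 -
        ∫ y, Real.log (awgnDensity μ N y).toReal ∂(awgnJoint μ N).snd) := by
  obtain ⟨h1, h1'⟩ := hasIntegral_log_likelihood (μ := μ) hN
  have h2 := (gibbs_awgnDensity (μ := μ) hN hμ hN).1
  rw [Measure.snd] at h2
  have hm : AEStronglyMeasurable (fun y => Real.log (awgnDensity μ N y).toReal)
      ((awgnJoint μ N).map Prod.snd) :=
    measurable_awgnDensity.ennreal_toReal.log.aestronglyMeasurable
  have h2' : Integrable (fun q : ℝ × ℝ => Real.log (awgnDensity μ N q.2).toReal)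
      (awgnJoint μ N) := (integrable_map_measure hm measurable_snd.aemeasurable).1 h2
  have hint : Integrable
      (llr (awgnJoint μ N) ((awgnJoint μ N).fst.prod (awgnJoint μ N).snd)) (awgnJoint μ N) :=
    (integrable_congr (llr_awgnJoint hN)).2 (h1.sub h2')
  have h3 : ∫ y, Real.log (awgnDensity μ N y).toReal ∂(awgnJoint μ N).snd =
      ∫ q, Real.log (awgnDensity μ N q.2).toReal ∂(awgnJoint μ N) :=
    integral_map measurable_snd.aemeasurable hm
  rw [InformationTheory.klDiv_of_ac_of_integrable (awgnJoint_absolutelyContinuous hN) hint,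
    integral_congr_ae (llr_awgnJoint hN), integral_sub h1 h2', h1', h3]
  simp

/-- A second moment of at most `P` limits the information to `½ log (1 + P / N)` nats: the output
density is compared with the Gaussian one of variance `P + N`. -/
lemma klDiv_awgnJoint_le [IsProbabilityMeasure μ] (hN : N ≠ 0) (P : ℝ≥0)
    (hμ : Integrable (fun u => u ^ 2) μ) (hP : ∫ u, u ^ 2 ∂μ ≤ P) :
    InformationTheory.klDiv (awgnJoint μ N) ((awgnJoint μ N).fst.prod (awgnJoint μ N).snd) ≤
      ENNReal.ofReal (1 / 2 * Real.log (1 + P / N)) := by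
  have hN' : (0 : ℝ) < N := lt_of_le_of_ne N.2 fun h => hN (NNReal.coe_eq_zero.1 h.symm)
  have hP0 : (0 : ℝ) ≤ P := P.2
  rw [klDiv_awgnJoint hN hμ]
  refine ENNReal.ofReal_le_ofReal ?_
  have h := (gibbs_awgnDensity (μ := μ) hN hμ (W := P + N)
    (fun h => hN (add_eq_zero.1 h).2)).2
  have hle : (∫ u, u ^ 2 ∂μ + N) / (2 * ((P + N : ℝ≥0) : ℝ)) ≤ 1 / 2 := by
    rw [NNReal.coe_add, div_le_div_iff₀ (by positivity) two_pos]
    linarith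
  have hlog : Real.log (1 + P / N) =
      Real.log (2 * Real.pi * ((P + N : ℝ≥0) : ℝ)) - Real.log (2 * Real.pi * N) := by
    rw [← Real.log_div (by positivity) (by positivity), NNReal.coe_add]
    congr 1
    field_simp
    ring
  rw [hlog]
  linarith

lemma klDiv_awgnJoint_gaussianReal (hN : N ≠ 0) (P : ℝ≥0) :
    InformationTheory.klDiv (awgnJoint (gaussianReal 0 P) N)
      ((awgnJoint (gaussianReal 0 P) N).fst.prod (awgnJoint (gaussianReal 0 P) N).snd) =
      ENNReal.ofReal (1 / 2 * Real.log (1 + P / N)) := by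
  have hN' : (0 : ℝ) < N := lt_of_le_of_ne N.2 fun h => hN (NNReal.coe_eq_zero.1 h.symm)
  have hP0 : (0 : ℝ) ≤ P := P.2
  have hW : P + N ≠ 0 := fun h => hN (add_eq_zero.1 h).2
  have hμ := integrable_sq_gaussianReal 0 P
  have hsnd : (awgnJoint (gaussianReal 0 P) N).snd = gaussianReal 0 (P + N) := by
    rw [Measure.snd, awgnJoint, Measure.map_map measurable_snd (by fun_prop)]
    refine Eq.trans gaussianReal_conv_gaussianReal ?_
    rw [add_zero]
  have hdens : awgnDensity (gaussianReal 0 P) N =ᵐ[volume] gaussianPDF 0 (P + N) := by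
    have h := (snd_awgnJoint (μ := gaussianReal 0 P) hN).symm.trans hsnd
    rw [gaussianReal_of_var_ne_zero 0 hW] at h
    exact (withDensity_eq_iff_of_sigmaFinite measurable_awgnDensity.aemeasurable
      (measurable_gaussianPDF _ _).aemeasurable).1 h
  have hint : ∫ y, Real.log (awgnDensity (gaussianReal 0 P) N y).toReal
      ∂(awgnJoint (gaussianReal 0 P) N).snd =
        -(Real.log (2 * Real.pi * ((P + N : ℝ≥0) : ℝ)) / 2) - 1 / 2 := by
    have h : (fun y => Real.log (awgnDensity (gaussianReal 0 P) N y).toReal)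
        =ᵐ[gaussianReal 0 (P + N)] fun y =>
          -(Real.log (2 * Real.pi * ((P + N : ℝ≥0) : ℝ)) / 2) -
            y ^ 2 / (2 * ((P + N : ℝ≥0) : ℝ)) := by
      filter_upwards [gaussianReal_absolutelyContinuous 0 hW hdens] with y hy
      rw [hy, toReal_gaussianPDF, log_gaussianPDFReal _ hW, sub_zero]
    rw [hsnd, integral_congr_ae h, integral_sub (integrable_const _)
      ((integrable_sq_gaussianReal 0 _).div_const _), integral_div, integral_sq_gaussianReal]
    have hW' : ((P + N : ℝ≥0) : ℝ) ≠ 0 := NNReal.coe_ne_zero.2 hW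
    rw [integral_const, probReal_univ, one_smul]
    congr 1
    field_simp
  rw [klDiv_awgnJoint hN hμ, hint]
  congr 1
  have hlog : Real.log (1 + P / N) =
      Real.log (2 * Real.pi * ((P + N : ℝ≥0) : ℝ)) - Real.log (2 * Real.pi * N) := by
    rw [← Real.log_div (by positivity) (by positivity), NNReal.coe_add]
    congr 1
    field_simp
    ring
  rw [hlog]
  ring

lemma integrable_sq_of_lintegral_le {P : ℝ} (hP : 0 ≤ P)
    (h : ∫⁻ u, ENNReal.ofReal (u ^ 2) ∂μ ≤ ENNReal.ofReal P) :
    Integrable (fun u => u ^ 2) μ ∧ ∫ u, u ^ 2 ∂μ ≤ P := by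
  have hm : AEStronglyMeasurable (fun u : ℝ => u ^ 2) μ :=
    (by fun_prop : Measurable fun y : ℝ => y ^ 2).aestronglyMeasurable
  constructor
  · refine ⟨hm, ?_⟩
    rw [hasFiniteIntegral_iff_ofReal (ae_of_all _ fun y => sq_nonneg y)]
    exact h.trans_lt ENNReal.ofReal_lt_top
  · rw [integral_eq_lintegral_of_nonneg_ae (ae_of_all _ fun y => sq_nonneg y) hm]
    exact ENNReal.toReal_le_of_le_ofReal hP h

end AWGN

/-! ### The largest mutual information for a given relay symbol -/

lemma ofReal_stateRate (α σ xth x : ℝ) :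
    ENNReal.ofReal (stateRate α σ xth x) =
      ENNReal.ofReal (1 / 2 * Real.log (1 + srcPower α xth x / noiseVar α σ x)) /
        ENNReal.ofReal (Real.log 2) := by
  rw [← ENNReal.ofReal_div_of_pos (Real.log_pos one_lt_two)]
  congr 1
  rw [stateRate, Real.logb, srcPower, noiseVar]
  ring

lemma isGreatest_infoValues {α σ : ℝ} (hα : 0 < α) (hσ : 0 < σ) (xth x : ℝ) :
    IsGreatest (infoValues α σ xth x) (ENNReal.ofReal (stateRate α σ xth x)) := by
  have hN := noiseVar_pos hα hσ x
  have hP := srcPower_nonneg hα xth x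
  have hN' : (noiseVar α σ x).toNNReal ≠ 0 := (Real.toNNReal_pos.2 hN).ne'
  constructor
  · refine ⟨gaussianReal 0 (srcPower α xth x).toNNReal, inferInstance, ?_, ?_⟩
    · rw [← ofReal_integral_eq_lintegral_ofReal (integrable_sq_gaussianReal _ _)
        (ae_of_all _ fun y => sq_nonneg y), integral_sq_gaussianReal, Real.coe_toNNReal _ hP]
    · rw [channelJoint_eq_awgnJoint hα, mutualInfo, klDiv_awgnJoint_gaussianReal hN',
        ofReal_stateRate, Real.coe_toNNReal _ hP, Real.coe_toNNReal _ hN.le]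
  · rintro I ⟨μ, hμ, hpow, rfl⟩
    obtain ⟨h1, h2⟩ := integrable_sq_of_lintegral_le hP hpow
    rw [channelJoint_eq_awgnJoint hα, mutualInfo, ofReal_stateRate]
    refine ENNReal.div_le_div_right ?_ _
    have := klDiv_awgnJoint_le hN' (srcPower α xth x).toNNReal h1
      (by rwa [Real.coe_toNNReal _ hP])
    rwa [Real.coe_toNNReal _ hP, Real.coe_toNNReal _ hN.le] at this

lemma stateRate_nonneg {α σ : ℝ} (hα : 0 < α) (hσ : 0 < σ) (xth x : ℝ) :
    0 ≤ stateRate α σ xth x := by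
  refine mul_nonneg (by norm_num) (Real.logb_nonneg one_lt_two ?_)
  have : 0 ≤ srcPower α xth x / noiseVar α σ x :=
    div_nonneg (srcPower_nonneg hα xth x) (noiseVar_pos hα hσ x).le
  rw [srcPower, noiseVar] at this
  linarith

lemma stateRate_le {α σ : ℝ} (hα : 0 < α) (hσ : 0 < σ) (xth x : ℝ) :
    stateRate α σ xth x ≤ 1 / 2 * Real.logb 2 (1 + α * xth ^ 2 / σ ^ 2) := by
  have hm : max 0 (xth ^ 2 - x ^ 2) ≤ xth ^ 2 :=
    max_le (sq_nonneg _) (by nlinarith [sq_nonneg x])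
  have h0 : 0 ≤ max 0 (xth ^ 2 - x ^ 2) := le_max_left _ _
  refine mul_le_mul_of_nonneg_left (Real.logb_le_logb_of_le one_lt_two (by positivity) ?_)
    (by norm_num)
  gcongr
  nlinarith [mul_nonneg hα.le (sq_nonneg x)]

lemma measurable_stateRate (α σ xth : ℝ) : Measurable (stateRate α σ xth) := by
  unfold stateRate Real.logb
  fun_prop

lemma integrable_stateRate {α σ : ℝ} (hα : 0 < α) (hσ : 0 < σ) (xth : ℝ) (p : Measure ℝ)
    [IsProbabilityMeasure p] : Integrable (stateRate α σ xth) p :=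
  integrable_of_le_of_le (measurable_stateRate α σ xth).aestronglyMeasurable
    (ae_of_all _ fun x => stateRate_nonneg hα hσ xth x)
    (ae_of_all _ fun x => stateRate_le hα hσ xth x) (integrable_const _) (integrable_const _)

lemma lintegral_sSup_infoValues {α σ : ℝ} (hα : 0 < α) (hσ : 0 < σ) (xth : ℝ) (p : Measure ℝ)
    [IsProbabilityMeasure p] :
    ∫⁻ x, sSup (infoValues α σ xth x) ∂p = ENNReal.ofReal (∫ x, stateRate α σ xth x ∂p) := by
  rw [ofReal_integral_eq_lintegral_ofReal (integrable_stateRate hα hσ xth p)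
    (ae_of_all _ fun x => stateRate_nonneg hα hσ xth x)]
  exact lintegral_congr fun x => (isGreatest_infoValues hα hσ xth x).isLUB.sSup_eq

/-! ### Entropies of the jointly Gaussian source and received symbols -/

/-- Received power `α x_th² + σ²` in an active position: the water level of the power
allocation, which does not depend on the relay symbol. -/
def recvPower (α σ xth : ℝ) : ℝ := α * xth ^ 2 + σ ^ 2

/-- Half the binary logarithm of the interference-plus-noise variance: the part of
`h(Y | X, S = s)` that depends on `s`. -/
def stateEnt (α σ s : ℝ) : ℝ := Real.logb 2 (noiseVar α σ s) / 2

/-- Mean of `stateEnt` over the active relay symbols. -/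
def meanStateEnt (α σ xth : ℝ) (p : Measure ℝ) : ℝ := ∫ s, stateEnt α σ s ∂(activeLaw xth p)

lemma recvPower_pos {α σ : ℝ} (hα : 0 < α) (hσ : 0 < σ) (xth : ℝ) : 0 < recvPower α σ xth := by
  unfold recvPower; positivity

lemma srcPower_add_noiseVar {α σ xth s : ℝ} (hs : |s| < xth) :
    srcPower α xth s + noiseVar α σ s = recvPower α σ xth := by
  have h : s ^ 2 ≤ xth ^ 2 := sq_le_sq' (by linarith [neg_abs_le s]) (by linarith [le_abs_self s])
  rw [srcPower, noiseVar, recvPower, max_eq_right (by linarith)]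
  ring

lemma logb_densX (x : ℝ) :
    Real.logb 2 (densX x) = -(Real.log (2 * Real.pi) + x ^ 2) / (2 * Real.log 2) := by
  rw [Real.logb, densX, log_gaussianPDFReal _ one_ne_zero]
  have := (Real.log_pos one_lt_two).ne'
  simp
  field_simp
  ring

lemma log_two_pi_mul {v : ℝ} (hv : 0 < v) :
    Real.log (2 * Real.pi * v) = Real.log (2 * Real.pi) + Real.log v :=
  Real.log_mul (by positivity) hv.ne'

lemma logb_densY {α σ xth s : ℝ} (hα : 0 < α) (hσ : 0 < σ) (hs : |s| < xth) (y : ℝ) :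
    Real.logb 2 (densY α σ xth s y) = -(Real.log (2 * Real.pi) + Real.log (recvPower α σ xth) +
      y ^ 2 / recvPower α σ xth) / (2 * Real.log 2) := by
  have hV := recvPower_pos hα hσ xth
  rw [Real.logb, densY, srcPower_add_noiseVar hs,
    log_gaussianPDFReal _ (Real.toNNReal_pos.2 hV).ne', Real.coe_toNNReal _ hV.le,
    log_two_pi_mul hV]
  have := (Real.log_pos one_lt_two).ne'
  field_simp
  ring

lemma logb_densXY {α σ : ℝ} (hα : 0 < α) (hσ : 0 < σ) (xth s x y : ℝ) :
    Real.logb 2 (densXY α σ xth s x y) =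
      -(2 * Real.log (2 * Real.pi) + x ^ 2 +
        (y - √(srcPower α xth s) * x) ^ 2 / noiseVar α σ s) / (2 * Real.log 2) -
        stateEnt α σ s := by
  have hN := noiseVar_pos hα hσ s
  have hN' := (Real.toNNReal_pos.2 hN).ne'
  have hX := logb_densX x
  have hX0 : densX x ≠ 0 := (gaussianPDFReal_pos 0 1 x one_ne_zero).ne'
  rw [densXY, Real.logb_mul hX0 (gaussianPDFReal_pos _ _ _ hN').ne', hX, Real.logb,
    log_gaussianPDFReal _ hN', Real.coe_toNNReal _ hN.le, log_two_pi_mul hN, stateEnt, Real.logb]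
  have := (Real.log_pos one_lt_two).ne'
  field_simp
  ring

lemma hasIntegral_mul_log_gaussianPDFReal {v : ℝ≥0} (hv : v ≠ 0) :
    Integrable (fun y => gaussianPDFReal 0 v y * Real.log (gaussianPDFReal 0 v y)) ∧
      ∫ y, gaussianPDFReal 0 v y * Real.log (gaussianPDFReal 0 v y) =
        -(Real.log (2 * Real.pi * v) + 1) / 2 := by
  have hv' : (v : ℝ) ≠ 0 := NNReal.coe_ne_zero.2 hv
  have hi : Integrable (fun y => Real.log (gaussianPDFReal 0 v y)) (gaussianReal 0 v) := by
    simp only [log_gaussianPDFReal _ hv]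
    refine (integrable_const _).sub (Integrable.div_const ?_ _)
    simpa using integrable_sq_gaussianReal 0 v
  constructor
  · rw [gaussianReal_of_var_ne_zero 0 hv, integrable_withDensity_iff
      (measurable_gaussianPDF 0 v) (ae_of_all _ fun _ => gaussianPDF_lt_top)] at hi
    refine hi.congr (ae_of_all _ fun y => ?_)
    simp only [toReal_gaussianPDF]
    ring
  · have h := integral_gaussianReal_eq_integral_smul (μ := 0) hv
      (f := fun y => Real.log (gaussianPDFReal 0 v y))
    simp only [smul_eq_mul] at h
    rw [← h]
    simp only [log_gaussianPDFReal _ hv, sub_zero]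
    rw [integral_sub (integrable_const _) ((integrable_sq_gaussianReal 0 v).div_const _),
      integral_div, integral_sq_gaussianReal, integral_const, probReal_univ, one_smul]
    field_simp
    ring

lemma entX_eq : entX = (Real.log (2 * Real.pi) + 1) / (2 * Real.log 2) := by
  have h := (hasIntegral_mul_log_gaussianPDFReal one_ne_zero).2
  rw [entX]
  simp only [Real.logb, densX, ← mul_div_assoc]
  rw [integral_div, h]
  have := (Real.log_pos one_lt_two).ne'
  simp
  field_simp
  ring

lemma integral_densY_mul_logb {α σ xth s : ℝ} (hα : 0 < α) (hσ : 0 < σ) (hs : |s| < xth) :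
    ∫ y, densY α σ xth s y * Real.logb 2 (densY α σ xth s y) =
      -(Real.log (2 * Real.pi) + Real.log (recvPower α σ xth) + 1) / (2 * Real.log 2) := by
  have hV := recvPower_pos hα hσ xth
  have h := (hasIntegral_mul_log_gaussianPDFReal (Real.toNNReal_pos.2 hV).ne').2
  simp only [Real.logb, densY, ← mul_div_assoc, srcPower_add_noiseVar hs]
  rw [integral_div, h, Real.coe_toNNReal _ hV.le, log_two_pi_mul hV]
  have := (Real.log_pos one_lt_two).ne'
  field_simp

/-- The shear `(x, v) ↦ (x, a x + v)` turns `densXY` into a product density. -/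
lemma integral_densXY_mul_logb {α σ : ℝ} (hα : 0 < α) (hσ : 0 < σ) (xth s : ℝ) :
    ∫ u : ℝ × ℝ, densXY α σ xth s u.1 u.2 * Real.logb 2 (densXY α σ xth s u.1 u.2) =
      -(Real.log (2 * Real.pi) + 1) / Real.log 2 - stateEnt α σ s := by
  have hN := noiseVar_pos hα hσ s
  have hN' := (Real.toNNReal_pos.2 hN).ne'
  set a := √(srcPower α xth s) with ha
  set N := (noiseVar α σ s).toNNReal with hNN
  have hshear : MeasurePreserving (fun q : ℝ × ℝ => (q.1, a * q.1 + q.2)) := by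
    refine (MeasurePreserving.id volume).skew_product (g := fun x v : ℝ => a * x + v)
      (by fun_prop) (ae_of_all _ fun x => ?_)
    exact (measurePreserving_add_left volume (a * x)).map_eq
  have hm : Measurable fun u : ℝ × ℝ => densXY α σ xth s u.1 u.2 := by
    unfold densXY densX gaussianPDFReal
    fun_prop
  obtain ⟨hX, hX'⟩ := hasIntegral_mul_log_gaussianPDFReal one_ne_zero
  obtain ⟨hV, hV'⟩ := hasIntegral_mul_log_gaussianPDFReal hN'
  have hX1 := integrable_gaussianPDFReal 0 1
  have hV1 := integrable_gaussianPDFReal 0 N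
  have hcomp : ∀ q : ℝ × ℝ, densXY α σ xth s q.1 (a * q.1 + q.2) *
      Real.log (densXY α σ xth s q.1 (a * q.1 + q.2)) =
      (gaussianPDFReal 0 1 q.1 * Real.log (gaussianPDFReal 0 1 q.1)) * gaussianPDFReal 0 N q.2 +
      gaussianPDFReal 0 1 q.1 * (gaussianPDFReal 0 N q.2 * Real.log (gaussianPDFReal 0 N q.2)) := by
    intro q
    have hg : gaussianPDFReal (a * q.1) N (a * q.1 + q.2) = gaussianPDFReal 0 N q.2 := by
      simp [gaussianPDFReal]
    rw [densXY, ← ha, ← hNN, hg, densX, Real.log_mul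
      (gaussianPDFReal_pos 0 1 _ one_ne_zero).ne' (gaussianPDFReal_pos _ _ _ hN').ne']
    ring
  have hlog := (Real.log_pos one_lt_two).ne'
  have hm2 : Measurable fun u : ℝ × ℝ =>
      densXY α σ xth s u.1 u.2 * Real.log (densXY α σ xth s u.1 u.2) := hm.mul hm.log
  simp only [Real.logb, ← mul_div_assoc]
  rw [integral_div, ← hshear.map_eq, integral_map hshear.measurable.aemeasurable
    hm2.aestronglyMeasurable]
  simp only [hcomp]
  rw [Measure.volume_eq_prod, integral_add (hX.mul_prod hV1) (hX1.mul_prod hV),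
    integral_prod_mul (fun x => gaussianPDFReal 0 1 x * Real.log (gaussianPDFReal 0 1 x)),
    integral_prod_mul (gaussianPDFReal 0 1)
      (fun v => gaussianPDFReal 0 N v * Real.log (gaussianPDFReal 0 N v)), hX', hV',
    integral_gaussianPDFReal_eq_one 0 hN', integral_gaussianPDFReal_eq_one 0 one_ne_zero,
    hNN, Real.coe_toNNReal _ hN.le, log_two_pi_mul hN, stateEnt, Real.logb]
  simp
  field_simp
  ring

variable {xth : ℝ} {p : Measure ℝ}

lemma measurableSet_abs_lt (xth : ℝ) : MeasurableSet {x : ℝ | |x| < xth} :=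
  measurableSet_lt (by fun_prop) measurable_const

lemma isProbabilityMeasure_activeLaw [IsFiniteMeasure p] (hτ : 0 < activeProb xth p) :
    IsProbabilityMeasure (activeLaw xth p) :=
  cond_isProbabilityMeasure fun h => by
    rw [activeProb, measureReal_def, h] at hτ
    simp at hτ

lemma ae_activeLaw_abs_lt : ∀ᵐ s ∂(activeLaw xth p), |s| < xth :=
  ae_cond_mem (measurableSet_abs_lt xth)

lemma activeProb_mul_integral_activeLaw [IsFiniteMeasure p] (hτ : 0 < activeProb xth p)
    (f : ℝ → ℝ) :
    activeProb xth p * ∫ s, f s ∂(activeLaw xth p) = ∫ s in {x | |x| < xth}, f s ∂p := by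
  rw [activeLaw, ProbabilityTheory.cond, integral_smul_measure, ENNReal.toReal_inv, smul_eq_mul,
    ← measureReal_def, ← activeProb, mul_inv_cancel_left₀ hτ.ne']

lemma measurable_stateEnt (α σ : ℝ) : Measurable (stateEnt α σ) := by
  unfold stateEnt Real.logb noiseVar
  fun_prop

/-- A bound for `stateEnt` on the active relay symbols. -/
def stateEntBound (α σ xth : ℝ) : ℝ :=
  max |Real.logb 2 (σ ^ 2) / 2| |Real.logb 2 (recvPower α σ xth) / 2|

lemma abs_stateEnt_le {α σ s : ℝ} (hα : 0 < α) (hσ : 0 < σ) (hs : |s| < xth) :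
    |stateEnt α σ s| ≤ stateEntBound α σ xth := by
  have h1 : σ ^ 2 ≤ noiseVar α σ s := by rw [noiseVar]; nlinarith [mul_nonneg hα.le (sq_nonneg s)]
  have h2 : noiseVar α σ s ≤ recvPower α σ xth := by
    rw [← srcPower_add_noiseVar hs]; linarith [srcPower_nonneg hα xth s]
  refine abs_le_max_abs_abs ?_ ?_
  · exact div_le_div_of_nonneg_right (Real.logb_le_logb_of_le one_lt_two (by positivity) h1)
      two_pos.le
  · exact div_le_div_of_nonneg_right (Real.logb_le_logb_of_le one_lt_two
      (noiseVar_pos hα hσ s) h2) two_pos.le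

lemma integrable_stateEnt {α σ : ℝ} [IsFiniteMeasure p] (hα : 0 < α) (hσ : 0 < σ)
    (hτ : 0 < activeProb xth p) : Integrable (stateEnt α σ) (activeLaw xth p) := by
  have := isProbabilityMeasure_activeLaw hτ
  refine Integrable.of_bound (measurable_stateEnt α σ).aestronglyMeasurable
    (stateEntBound α σ xth) ?_
  filter_upwards [ae_activeLaw_abs_lt] with s hs using abs_stateEnt_le hα hσ hs

lemma entY_eq {α σ : ℝ} [IsFiniteMeasure p] (hα : 0 < α) (hσ : 0 < σ)
    (hτ : 0 < activeProb xth p) :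
    entY α σ xth p =
      (Real.log (2 * Real.pi) + Real.log (recvPower α σ xth) + 1) / (2 * Real.log 2) := by
  have := isProbabilityMeasure_activeLaw hτ
  rw [entY, integral_congr_ae (g := fun _ =>
    -(Real.log (2 * Real.pi) + Real.log (recvPower α σ xth) + 1) / (2 * Real.log 2))]
  · rw [integral_const, probReal_univ, one_smul]
    ring
  · filter_upwards [ae_activeLaw_abs_lt] with s hs using integral_densY_mul_logb hα hσ hs

lemma entXY_eq {α σ : ℝ} [IsFiniteMeasure p] (hα : 0 < α) (hσ : 0 < σ)
    (hτ : 0 < activeProb xth p) :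
    entXY α σ xth p =
      (Real.log (2 * Real.pi) + 1) / Real.log 2 + meanStateEnt α σ xth p := by
  have := isProbabilityMeasure_activeLaw hτ
  rw [entXY]
  simp only [integral_densXY_mul_logb hα hσ]
  rw [integral_sub (integrable_const _) (integrable_stateEnt hα hσ hτ), integral_const,
    probReal_univ, one_smul, meanStateEnt]
  ring

/-- The information `I(X; Y | S)` per active position, as it enters the error exponent. -/
def activeInfo (α σ xth : ℝ) (p : Measure ℝ) : ℝ :=
  entX + entY α σ xth p - entXY α σ xth p

lemma stateRate_of_abs_lt {α σ s : ℝ} (hα : 0 < α) (hσ : 0 < σ) (hs : |s| < xth) :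
    stateRate α σ xth s = Real.logb 2 (recvPower α σ xth) / 2 - stateEnt α σ s := by
  have hN := noiseVar_pos hα hσ s
  have h : 1 + α * max 0 (xth ^ 2 - s ^ 2) / (σ ^ 2 + α * s ^ 2) =
      recvPower α σ xth / noiseVar α σ s := by
    rw [← srcPower_add_noiseVar hs, add_div, div_self hN.ne', add_comm]
    rfl
  rw [stateRate, h, Real.logb_div (recvPower_pos hα hσ xth).ne' hN.ne', stateEnt]
  ring

lemma stateRate_of_le_abs {α σ s : ℝ} (hxth : 0 < xth) (hs : xth ≤ |s|) :
    stateRate α σ xth s = 0 := by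
  have h : xth ^ 2 ≤ s ^ 2 := by rw [← sq_abs s]; gcongr
  rw [stateRate, max_eq_left (by linarith)]
  simp

/-- Positions outside the active set carry no information, so the rate per symbol interval is the
fraction of active positions times the information per active position. -/
lemma integral_stateRate_eq {α σ : ℝ} [IsProbabilityMeasure p] (hα : 0 < α) (hσ : 0 < σ)
    (hxth : 0 < xth) (hτ : 0 < activeProb xth p) :
    ∫ x, stateRate α σ xth x ∂p = activeProb xth p * activeInfo α σ xth p := by
  have := isProbabilityMeasure_activeLaw hτ
  have h : activeInfo α σ xth p = ∫ s, stateRate α σ xth s ∂(activeLaw xth p) := by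
    rw [integral_congr_ae (g := fun s => Real.logb 2 (recvPower α σ xth) / 2 - stateEnt α σ s),
      integral_sub (integrable_const _) (integrable_stateEnt hα hσ hτ), integral_const,
      probReal_univ, one_smul, activeInfo, entX_eq, entY_eq hα hσ hτ, entXY_eq hα hσ hτ,
      meanStateEnt, Real.logb]
    · have := (Real.log_pos one_lt_two).ne'
      field_simp
      ring
    · filter_upwards [ae_activeLaw_abs_lt] with s hs using stateRate_of_abs_lt hα hσ hs
  rw [h, activeProb_mul_integral_activeLaw hτ, setIntegral_eq_integral_of_forall_compl_eq_zero]
  intro x hx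
  exact stateRate_of_le_abs hxth (not_lt.1 hx)

lemma activeProb_pos {α : ℝ} [IsFiniteMeasure p] (hxth : 0 < xth)
    (h : 0 < ∫ x, srcPower α xth x ∂p) : 0 < activeProb xth p := by
  refine lt_of_le_of_ne measureReal_nonneg fun h0 => h.ne' ?_
  refine integral_eq_zero_of_ae ?_
  have hz : p {x | |x| < xth} = 0 := by
    have := h0.symm
    rwa [activeProb, measureReal_eq_zero_iff] at this
  have : ∀ᵐ x ∂p, ¬ |x| < xth := measure_eq_zero_iff_ae_notMem.1 hz
  filter_upwards [this] with x hx
  have h : xth ^ 2 ≤ x ^ 2 := by rw [← sq_abs x]; gcongr; exact not_lt.1 hx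
  simp [srcPower, max_eq_left (sub_nonpos.2 h)]

/-! ### Chebyshev's inequality for sums over independent coordinates -/

lemma chebyshev_pi {E : Type*} [MeasurableSpace E] {ρ : Measure E} [IsProbabilityMeasure ρ]
    {m : ℕ} (hm : 0 < m) (X : Fin m → E → ℝ) {K c δ : ℝ} (hX : ∀ r, MemLp (X r) 2 ρ)
    (hmean : ∀ r, ∫ t, X r t ∂ρ = c) (hvar : ∀ r, Var[X r; ρ] ≤ K) (hδ : 0 < δ) :
    (Measure.pi fun _ : Fin m => ρ) {ω | m * δ ≤ |∑ r, X r (ω r) - m * c|} ≤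
      ENNReal.ofReal (K / (m * δ ^ 2)) := by
  have hm' : (0 : ℝ) < m := Nat.cast_pos.2 hm
  have hev : ∀ r : Fin m, MeasurePreserving (Function.eval r)
      (Measure.pi fun _ : Fin m => ρ) ρ := fun r => measurePreserving_eval _ r
  have hL : ∀ r, MemLp (fun ω : Fin m → E => X r (ω r)) 2 (Measure.pi fun _ : Fin m => ρ) :=
    fun r => (hX r).comp_measurePreserving (hev r)
  have hsum : MemLp (∑ r, fun ω : Fin m → E => X r (ω r)) 2 (Measure.pi fun _ : Fin m => ρ) :=
    memLp_finsetSum' _ fun r _ => hL r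
  have hint : ∫ ω, (∑ r, fun ω : Fin m → E => X r (ω r)) ω ∂(Measure.pi fun _ : Fin m => ρ) =
      m * c := by
    simp only [Finset.sum_apply]
    rw [integral_finsetSum _ fun r _ => (hL r).integrable one_le_two]
    have : ∀ r, ∫ ω : Fin m → E, X r (ω r) ∂(Measure.pi fun _ : Fin m => ρ) = c := by
      intro r
      have h := integral_map (hev r).measurable.aemeasurable (f := X r)
        (by rw [(hev r).map_eq]; exact (hX r).aestronglyMeasurable)
      rw [(hev r).map_eq, hmean r] at h
      exact h.symm
    simp [this]
  have h := meas_ge_le_variance_div_sq hsum (mul_pos hm' hδ)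
  rw [hint, variance_sum_pi hX] at h
  simp only [Finset.sum_apply] at h
  refine h.trans (ENNReal.ofReal_le_ofReal ?_)
  have : ∑ r, Var[X r; ρ] ≤ m * K :=
    (Finset.sum_le_sum fun r _ => hvar r).trans (by simp)
  calc (∑ r, Var[X r; ρ]) / (m * δ) ^ 2 ≤ (m * K) / (m * δ) ^ 2 := by gcongr
    _ = K / (m * δ ^ 2) := by field_simp

/-- Variance of the square of a standard Gaussian variable. -/
def chiSqVar : ℝ := Var[fun x => x ^ 2; gaussianReal 0 1]

lemma memLp_sq_gaussianReal : MemLp (fun x : ℝ => x ^ 2) 2 (gaussianReal 0 1) := by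
  have hm : AEStronglyMeasurable (fun x : ℝ => x ^ 2) (gaussianReal 0 1) :=
    (by fun_prop : Measurable fun x : ℝ => x ^ 2).aestronglyMeasurable
  rw [memLp_two_iff_integrable_sq hm]
  have h := (memLp_id_gaussianReal (μ := 0) (v := 1) 4).integrable_norm_pow (by norm_num)
  refine h.congr (ae_of_all _ fun x => ?_)
  simp only [id, Real.norm_eq_abs]
  rw [← pow_mul]
  exact Even.pow_abs (by decide) x

lemma sum_sq_deviation_le {E : Type*} [MeasurableSpace E] {ρ : Measure E}
    [IsProbabilityMeasure ρ] {m : ℕ} (hm : 0 < m) (W : Fin m → E → ℝ)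
    (hW : ∀ r, Measurable (W r)) (hlaw : ∀ r, ρ.map (W r) = gaussianReal 0 1) {δ : ℝ}
    (hδ : 0 < δ) :
    (Measure.pi fun _ : Fin m => ρ) {ω | m * δ ≤ |∑ r, W r (ω r) ^ 2 - m|} ≤
      ENNReal.ofReal (chiSqVar / (m * δ ^ 2)) := by
  have hsq : ∀ ν : Measure ℝ, AEStronglyMeasurable (fun x : ℝ => x ^ 2) ν :=
    fun ν => (by fun_prop : Measurable fun x : ℝ => x ^ 2).aestronglyMeasurable
  have h := chebyshev_pi hm (fun r t => W r t ^ 2) (ρ := ρ) (K := chiSqVar) (c := 1)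
    (fun r => ?_) (fun r => ?_) (fun r => ?_) hδ
  · simpa only [mul_one] using h
  · have := memLp_sq_gaussianReal
    rw [← hlaw r] at this
    exact (memLp_map_measure_iff (hsq _) (hW r).aemeasurable).1 this
  · have := integral_map (hW r).aemeasurable (μ := ρ) (hsq _)
    rw [hlaw r, integral_sq_gaussianReal] at this
    simpa using this.symm
  · refine le_of_eq ?_
    have := variance_map (X := fun x : ℝ => x ^ 2) (Y := W r) (μ := ρ)
      (hsq _).aemeasurable (hW r).aemeasurable
    rw [hlaw r] at this
    exact this.symm

/-! ### Typicality of the transmitted codeword -/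

/-- Law of the source codeword symbol, the gain and the noise in one symbol interval. -/
def symbolLaw (α σ : ℝ) : Measure (ℝ × ℝ × ℝ) :=
  (gaussianReal 0 1).prod ((gainLaw α).prod (noiseLaw σ))

instance (α σ : ℝ) : IsProbabilityMeasure (symbolLaw α σ) := by
  unfold symbolLaw; infer_instance

/-- The received symbol in an active position with relay symbol `s`, as a function of the source
codeword symbol, the gain and the noise. -/
def activeOutput (α xth s : ℝ) (t : ℝ × ℝ × ℝ) : ℝ :=
  relayOutput (√(srcPower α xth s) * t.1) s t.2.1 t.2.2

lemma measurable_activeOutput (α xth s : ℝ) : Measurable (activeOutput α xth s) := by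
  unfold activeOutput relayOutput; fun_prop

lemma map_fst_symbolLaw (α σ : ℝ) : (symbolLaw α σ).map (fun t => t.1) = gaussianReal 0 1 :=
  Measure.fst_prod

lemma map_snd_symbolLaw {α σ : ℝ} (hα : 0 < α) (s : ℝ) :
    (symbolLaw α σ).map (fun t => t.2.1 * s + t.2.2) =
      gaussianReal 0 (noiseVar α σ s).toNNReal := by
  have h : (fun t : ℝ × ℝ × ℝ => t.2.1 * s + t.2.2) =
      (fun q : ℝ × ℝ => q.1 * s + q.2) ∘ Prod.snd := rfl
  have h2 : (symbolLaw α σ).map Prod.snd = (gainLaw α).prod (noiseLaw σ) := Measure.snd_prod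
  rw [h, ← Measure.map_map (by fun_prop) measurable_snd, h2, map_interference_noise hα]

lemma map_activeOutput {α σ xth s : ℝ} (hα : 0 < α) (hσ : 0 < σ) (hs : |s| < xth) :
    (symbolLaw α σ).map (activeOutput α xth s) =
      gaussianReal 0 (recvPower α σ xth).toNNReal := by
  have h : activeOutput α xth s = (fun q : ℝ × ℝ => √(srcPower α xth s) * q.1 + 1 * q.2) ∘
      Prod.map id (fun q : ℝ × ℝ => q.1 * s + q.2) := by
    funext t
    simp [activeOutput, relayOutput, add_assoc]
  rw [h, ← Measure.map_map (by fun_prop) (by fun_prop), symbolLaw,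
    ← Measure.map_prod_map _ _ measurable_id (by fun_prop), map_interference_noise hα,
    Measure.map_id, gaussianReal_prod_map_linear, Real.sq_sqrt (srcPower_nonneg hα xth s),
    Real.coe_toNNReal _ (noiseVar_pos hα hσ s).le, ← srcPower_add_noiseVar hs]
  simp

lemma map_div_sqrt_gaussianReal {E : Type*} [MeasurableSpace E] {ρ : Measure E} {W : E → ℝ}
    (hW : Measurable W) {v : ℝ} (hv : 0 < v) (h : ρ.map W = gaussianReal 0 v.toNNReal) :
    ρ.map (fun t => W t / √v) = gaussianReal 0 1 := by
  have hc : (fun t => W t / √v) = (fun x => x / √v) ∘ W := rfl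
  rw [hc, ← Measure.map_map (by fun_prop) hW, h, gaussianReal_map_div_const, zero_div]
  congr 1
  rw [← NNReal.coe_inj]
  push_cast
  rw [Real.coe_toNNReal _ hv.le, Real.sq_sqrt hv.le, div_self hv.ne']

/-- The relay symbols `s` are typical when their empirical mean of `stateEnt` is within `ε / 2` of
the true mean. This is the part of joint typicality that only the relay codeword can violate. -/
def StateTypical (α σ xth : ℝ) (p : Measure ℝ) (ε : ℝ) {m : ℕ} (s : Fin m → ℝ) : Prop :=
  |∑ r, stateEnt α σ (s r) - m * meanStateEnt α σ xth p| ≤ m * (ε / 2)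

lemma abs_div_two_log_two_lt {m ε a : ℝ} (hm : 0 < m) (hε : 0 < ε) (h : |a| < m * (ε / 2)) :
    |a / (m * (2 * Real.log 2))| < ε / 2 := by
  have hlog : 1 / 2 < Real.log 2 := by linarith [Real.log_two_gt_d9]
  have h1 : 0 < m * (2 * Real.log 2) := by positivity
  rw [abs_div, abs_of_pos h1, div_lt_iff₀ h1]
  nlinarith [mul_pos hm hε]

/-- Apart from the mean of `stateEnt`, the three empirical entropies deviate from their means by
`1 / (2 log 2) < 1` times the normalized deviations of the sums of squares. -/
lemma jointlyTypical_of_sums {α σ ε : ℝ} [IsProbabilityMeasure p] (hα : 0 < α) (hσ : 0 < σ)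
    (hτ : 0 < activeProb xth p) (hε : 0 < ε) {m : ℕ} (hm : 0 < m) {s x y : Fin m → ℝ}
    (hs : ∀ r, |s r| < xth) (hst : StateTypical α σ xth p ε s)
    (h1 : |∑ r, x r ^ 2 - m| < m * (ε / 4))
    (h2 : |∑ r, y r ^ 2 / recvPower α σ xth - m| < m * (ε / 4))
    (h3 : |∑ r, (y r - √(srcPower α xth (s r)) * x r) ^ 2 / noiseVar α σ (s r) - m| <
      m * (ε / 4)) :
    JointlyTypical α σ xth p ε s x y := by
  have hm' : (0 : ℝ) < m := Nat.cast_pos.2 hm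
  have hlog := (Real.log_pos one_lt_two).ne'
  have hhalf : m * (ε / 4) < m * (ε / 2) := by nlinarith [mul_pos hm' hε]
  refine ⟨?_, ?_, ?_⟩
  · have e : -(1 / (m : ℝ)) * ∑ r, Real.logb 2 (densX (x r)) - entX =
        (∑ r, x r ^ 2 - m) / (m * (2 * Real.log 2)) := by
      simp only [logb_densX, entX_eq]
      rw [← Finset.sum_div, Finset.sum_neg_distrib, Finset.sum_add_distrib, Finset.sum_const,
        Finset.card_univ, Fintype.card_fin, nsmul_eq_mul]
      field_simp
      ring
    rw [e]
    exact (abs_div_two_log_two_lt hm' hε (h1.trans hhalf)).trans (half_lt_self hε)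
  · have e : -(1 / (m : ℝ)) * ∑ r, Real.logb 2 (densY α σ xth (s r) (y r)) - entY α σ xth p =
        (∑ r, y r ^ 2 / recvPower α σ xth - m) / (m * (2 * Real.log 2)) := by
      simp only [logb_densY hα hσ (hs _), entY_eq hα hσ hτ]
      rw [← Finset.sum_div, Finset.sum_neg_distrib, Finset.sum_add_distrib, Finset.sum_const,
        Finset.card_univ, Fintype.card_fin, nsmul_eq_mul]
      generalize ∑ r, y r ^ 2 / recvPower α σ xth = S
      field_simp
      ring
    rw [e]
    exact (abs_div_two_log_two_lt hm' hε (h2.trans hhalf)).trans (half_lt_self hε)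
  · have e : -(1 / (m : ℝ)) * ∑ r, Real.logb 2 (densXY α σ xth (s r) (x r) (y r)) -
        entXY α σ xth p =
        ((∑ r, x r ^ 2 - m) +
          (∑ r, (y r - √(srcPower α xth (s r)) * x r) ^ 2 / noiseVar α σ (s r) - m)) /
            (m * (2 * Real.log 2)) +
        (∑ r, stateEnt α σ (s r) - m * meanStateEnt α σ xth p) / m := by
      simp only [logb_densXY hα hσ, entXY_eq hα hσ hτ]
      rw [Finset.sum_sub_distrib, ← Finset.sum_div, Finset.sum_neg_distrib,
        Finset.sum_add_distrib, Finset.sum_add_distrib, Finset.sum_const,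
        Finset.card_univ, Fintype.card_fin, nsmul_eq_mul]
      generalize ∑ r, (y r - √(srcPower α xth (s r)) * x r) ^ 2 / noiseVar α σ (s r) = S
      field_simp
      ring
    rw [e]
    have ha := abs_div_two_log_two_lt hm' hε
      (((abs_add_le _ _).trans_lt (add_lt_add h1 h3)).trans_eq (by ring))
    have hb : |(∑ r, stateEnt α σ (s r) - m * meanStateEnt α σ xth p) / m| ≤ ε / 2 := by
      rw [abs_div, abs_of_pos hm', div_le_iff₀ hm', mul_comm (ε / 2)]
      exact hst
    exact (abs_add_le _ _).trans_lt (by linarith)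

/-- With typical relay symbols, the transmitted codeword fails to be jointly typical with the
received symbols with probability `O(1 / m)`. -/
lemma measure_not_jointlyTypical_le {α σ ε : ℝ} [IsProbabilityMeasure p] (hα : 0 < α)
    (hσ : 0 < σ) (hτ : 0 < activeProb xth p) (hε : 0 < ε) {m : ℕ} (hm : 0 < m) {s : Fin m → ℝ}
    (hs : ∀ r, |s r| < xth) (hst : StateTypical α σ xth p ε s) :
    (Measure.pi fun _ : Fin m => symbolLaw α σ) {t | ¬ JointlyTypical α σ xth p ε s
      (fun r => (t r).1) (fun r => activeOutput α xth (s r) (t r))} ≤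
      3 * ENNReal.ofReal (chiSqVar / (m * (ε / 4) ^ 2)) := by
  have hV := recvPower_pos hα hσ xth
  obtain ⟨δ, hδe⟩ : ∃ δ, δ = ε / 4 := ⟨_, rfl⟩
  have hδ : 0 < δ := by linarith
  rw [← hδe]
  have b1 := sum_sq_deviation_le (ρ := symbolLaw α σ) hm (fun _ t => t.1)
    (fun _ => measurable_fst) (fun _ => map_fst_symbolLaw α σ) hδ
  have b2 := sum_sq_deviation_le (ρ := symbolLaw α σ) hm
    (fun r t => activeOutput α xth (s r) t / √(recvPower α σ xth))
    (fun r => (measurable_activeOutput _ _ _).div_const _)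
    (fun r => map_div_sqrt_gaussianReal (measurable_activeOutput _ _ _) hV
      (map_activeOutput hα hσ (hs r))) hδ
  have b3 := sum_sq_deviation_le (ρ := symbolLaw α σ) hm
    (fun r t => (t.2.1 * s r + t.2.2) / √(noiseVar α σ (s r)))
    (fun r => by fun_prop)
    (fun r => map_div_sqrt_gaussianReal (by fun_prop) (noiseVar_pos hα hσ _)
      (map_snd_symbolLaw hα (s r))) hδ
  simp only [div_pow, Real.sq_sqrt hV.le, Real.sq_sqrt (noiseVar_pos hα hσ _).le] at b2 b3
  have b := (measure_union_le _ _).trans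
    (add_le_add b1 ((measure_union_le _ _).trans (add_le_add b2 b3)))
  rw [show ∀ a : ℝ≥0∞, a + (a + a) = 3 * a from fun a => by ring] at b
  refine (measure_mono fun t ht => ?_).trans b
  by_contra hcon
  obtain ⟨hc1, hc⟩ := not_or.1 hcon
  obtain ⟨hc2, hc3⟩ := not_or.1 hc
  rw [Set.mem_ofPred_eq, not_le] at hc1 hc2 hc3
  rw [hδe] at hc1 hc2 hc3
  refine ht (jointlyTypical_of_sums hα hσ hτ hε hm hs hst hc1 hc2 ?_)
  have e : ∀ r, activeOutput α xth (s r) (t r) - √(srcPower α xth (s r)) * (t r).1 =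
      (t r).2.1 * s r + (t r).2.2 := by
    intro r
    rw [activeOutput, relayOutput]
    ring
  simpa only [e] using hc3

/-! ### Typicality of an independent codeword -/

/-- The likelihood ratio of a pair of source and received symbols: jointly Gaussian against
independent, given the relay symbol `s`. -/
def likelihoodRatio (α σ xth s y x : ℝ) : ℝ :=
  densXY α σ xth s x y / (densX x * densY α σ xth s y)

lemma densX_pos (x : ℝ) : 0 < densX x := gaussianPDFReal_pos 0 1 x one_ne_zero

lemma densY_pos {α σ : ℝ} (hα : 0 < α) (hσ : 0 < σ) (xth s y : ℝ) :
    0 < densY α σ xth s y :=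
  gaussianPDFReal_pos _ _ _
    (Real.toNNReal_pos.2 (add_pos_of_nonneg_of_pos (srcPower_nonneg hα xth s)
      (noiseVar_pos hα hσ s))).ne'

lemma densXY_pos {α σ : ℝ} (hα : 0 < α) (hσ : 0 < σ) (xth s x y : ℝ) :
    0 < densXY α σ xth s x y :=
  mul_pos (densX_pos x)
    (gaussianPDFReal_pos _ _ _ (Real.toNNReal_pos.2 (noiseVar_pos hα hσ s)).ne')

lemma likelihoodRatio_pos {α σ : ℝ} (hα : 0 < α) (hσ : 0 < σ) (xth s y x : ℝ) :
    0 < likelihoodRatio α σ xth s y x :=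
  div_pos (densXY_pos hα hσ xth s x y) (mul_pos (densX_pos x) (densY_pos hα hσ xth s y))

lemma measurable_likelihoodRatio (α σ xth s y : ℝ) :
    Measurable (likelihoodRatio α σ xth s y) := by
  unfold likelihoodRatio densXY densX densY gaussianPDFReal
  fun_prop

/-- The likelihood ratio has mean one under an independent codeword symbol, for every received
symbol: it is the ratio of the posterior density to the prior. -/
lemma lintegral_likelihoodRatio {α σ : ℝ} (hα : 0 < α) (hσ : 0 < σ) (xth s y : ℝ) :
    ∫⁻ x, ENNReal.ofReal (likelihoodRatio α σ xth s y x) ∂(gaussianReal 0 1) = 1 := by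
  have hP := srcPower_nonneg hα xth s
  have hN := noiseVar_pos hα hσ s
  have hV : 0 < srcPower α xth s + noiseVar α σ s := add_pos_of_nonneg_of_pos hP hN
  rw [gaussianReal_of_var_ne_zero 0 one_ne_zero, lintegral_withDensity_eq_lintegral_mul _
    (measurable_gaussianPDF 0 1) (measurable_likelihoodRatio α σ xth s y).ennreal_ofReal,
    ← lintegral_gaussianPDF_eq_one
      (√(srcPower α xth s) * y / (srcPower α xth s + noiseVar α σ s))
      (Real.toNNReal_pos.2 (div_pos hN hV)).ne']
  refine lintegral_congr fun x => ?_
  rw [Pi.mul_apply, gaussianPDF, ← ENNReal.ofReal_mul (gaussianPDFReal_nonneg _ _ _), gaussianPDF]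
  congr 1
  have h := gaussianPDFReal_mul_eq_evidence_mul_posterior (√(srcPower α xth s)) hN x y
  rw [Real.sq_sqrt hP] at h
  have hx : gaussianPDFReal 0 1 x ≠ 0 := (densX_pos x).ne'
  have hy : gaussianPDFReal 0 (srcPower α xth s + noiseVar α σ s).toNNReal y ≠ 0 :=
    (densY_pos hα hσ xth s y).ne'
  rw [likelihoodRatio, densXY, densX, densY, h]
  field_simp

lemma lintegral_pi_prod {E : Type*} [MeasurableSpace E] {ρ : Measure E} [IsProbabilityMeasure ρ]
    {m : ℕ} (f : Fin m → E → ℝ≥0∞) (hf : ∀ r, Measurable (f r)) :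
    ∫⁻ ω, ∏ r, f r (ω r) ∂(Measure.pi fun _ : Fin m => ρ) = ∏ r, ∫⁻ t, f r t ∂ρ := by
  rw [lintegral_prod_eq_prod_lintegral_of_indepFun Finset.univ (fun r (ω : Fin m → E) => f r (ω r))
    (iIndepFun_pi fun r => (hf r).aemeasurable) (fun r => (hf r).comp (measurable_pi_apply r))]
  refine Finset.prod_congr rfl fun r _ => ?_
  exact (measurePreserving_eval (fun _ : Fin m => ρ) r).lintegral_comp (hf r)

/-- Joint typicality forces a large likelihood ratio; each of the three entropies contributes one
`ε`. -/
lemma le_prod_likelihoodRatio {α σ ε : ℝ} (hα : 0 < α) (hσ : 0 < σ) {m : ℕ}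
    {s x y : Fin m → ℝ} (h : JointlyTypical α σ xth p ε s x y) :
    (2 : ℝ) ^ ((m : ℝ) * (activeInfo α σ xth p - 3 * ε)) ≤
      ∏ r, likelihoodRatio α σ xth (s r) (y r) (x r) := by
  rcases Nat.eq_zero_or_pos m with rfl | hm
  · simp
  have hm' : (0 : ℝ) < m := Nat.cast_pos.2 hm
  have hlog : Real.logb 2 (∏ r, likelihoodRatio α σ xth (s r) (y r) (x r)) =
      ∑ r, Real.logb 2 (densXY α σ xth (s r) (x r) (y r)) -
        (∑ r, Real.logb 2 (densX (x r)) + ∑ r, Real.logb 2 (densY α σ xth (s r) (y r))) := by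
    rw [Real.logb_prod _ _ fun r _ => (likelihoodRatio_pos hα hσ xth _ _ _).ne',
      ← Finset.sum_add_distrib, ← Finset.sum_sub_distrib]
    refine Finset.sum_congr rfl fun r _ => ?_
    have hX := (densX_pos (x r)).ne'
    have hY := (densY_pos hα hσ xth (s r) (y r)).ne'
    rw [likelihoodRatio, Real.logb_div (densXY_pos hα hσ xth _ _ _).ne' (mul_ne_zero hX hY),
      Real.logb_mul hX hY]
  rw [← Real.le_logb_iff_rpow_le one_lt_two
    (Finset.prod_pos fun r _ => likelihoodRatio_pos hα hσ xth _ _ _), hlog]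
  obtain ⟨h1, h2, h3⟩ := h
  have e1 := (abs_lt.1 h1).1
  have e2 := (abs_lt.1 h2).1
  have e3 := (abs_lt.1 h3).2
  generalize ∑ r, Real.logb 2 (densX (x r)) = A at *
  generalize ∑ r, Real.logb 2 (densY α σ xth (s r) (y r)) = B at *
  generalize ∑ r, Real.logb 2 (densXY α σ xth (s r) (x r) (y r)) = C at *
  have key : activeInfo α σ xth p - 3 * ε ≤ (C - (A + B)) / m := by
    have e : (C - (A + B)) / m = -(1 / (m : ℝ)) * A + -(1 / (m : ℝ)) * B - -(1 / (m : ℝ)) * C := by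
      ring
    rw [e, activeInfo]
    linarith
  rw [le_div_iff₀ hm'] at key
  linarith

/-- An independent codeword is jointly typical with given received symbols with probability at
most `2 ^ (-m (I(X; Y | S) - 3 ε))`. -/
lemma measure_jointlyTypical_indep_le {α σ ε : ℝ} (hα : 0 < α) (hσ : 0 < σ) {m : ℕ}
    (s y : Fin m → ℝ) :
    (Measure.pi fun _ : Fin m => gaussianReal 0 1) {x | JointlyTypical α σ xth p ε s x y} ≤
      ENNReal.ofReal ((2 : ℝ) ^ (-((m : ℝ) * (activeInfo α σ xth p - 3 * ε)))) := by
  set c : ℝ := (2 : ℝ) ^ ((m : ℝ) * (activeInfo α σ xth p - 3 * ε)) with hc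
  have hcpos : 0 < c := by positivity
  have hL : ∀ r, Measurable fun x => ENNReal.ofReal (likelihoodRatio α σ xth (s r) (y r) x) :=
    fun r => (measurable_likelihoodRatio _ _ _ _ _).ennreal_ofReal
  have hmarkov := meas_ge_le_lintegral_div (μ := Measure.pi fun _ : Fin m => gaussianReal 0 1)
    (f := fun x => ∏ r, ENNReal.ofReal (likelihoodRatio α σ xth (s r) (y r) (x r)))
    (Finset.measurable_prod _ fun r _ => (hL r).comp (measurable_pi_apply r)).aemeasurable
    (ε := ENNReal.ofReal c) (ENNReal.ofReal_pos.2 hcpos).ne' ENNReal.ofReal_ne_top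
  rw [lintegral_pi_prod _ hL] at hmarkov
  simp only [lintegral_likelihoodRatio hα hσ, Finset.prod_const_one] at hmarkov
  rw [Real.rpow_neg two_pos.le, ← hc, ENNReal.ofReal_inv_of_pos hcpos, ← one_div]
  refine (measure_mono fun x hx => ?_).trans hmarkov
  rw [Set.mem_ofPred_eq, ← ENNReal.ofReal_prod_of_nonneg
    fun r _ => (likelihoodRatio_pos hα hσ xth _ _ _).le]
  exact ENNReal.ofReal_le_ofReal (le_prod_likelihoodRatio hα hσ hx)

/-! ### The symbols of one slot in their active positions -/

/-- The first `min n |A|` elements of `A`, in increasing order. -/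
def leadPos (n : ℕ) {k : ℕ} (A : Finset (Fin k)) (r : Fin (min n A.card)) : Fin k :=
  A.orderEmbOfFin rfl (r.castLE (min_le_right _ _))

/-- The source codeword symbol, the gain and the noise in the intervals in which a codeword symbol
is transmitted, if the set of active positions is `A`. -/
def gather {n k : ℕ} (A : Finset (Fin k)) (t : (Fin n → ℝ) × (Fin k → ℝ) × (Fin k → ℝ))
    (r : Fin (min n A.card)) : ℝ × ℝ × ℝ :=
  (t.1 (r.castLE (min_le_left _ _)), t.2.1 (leadPos n A r), t.2.2 (leadPos n A r))

/-- Law of the source codeword, the gains and the noises of one slot. -/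
def slotLaw (α σ : ℝ) (n k : ℕ) : Measure ((Fin n → ℝ) × (Fin k → ℝ) × (Fin k → ℝ)) :=
  (Measure.pi fun _ => gaussianReal 0 1).prod
    ((Measure.pi fun _ => gainLaw α).prod (Measure.pi fun _ => noiseLaw σ))

instance (α σ : ℝ) (n k : ℕ) : IsProbabilityMeasure (slotLaw α σ n k) := by
  unfold slotLaw; infer_instance

lemma leadPos_injective (n : ℕ) {k : ℕ} (A : Finset (Fin k)) :
    Function.Injective (leadPos n A) :=
  (A.orderEmbOfFin rfl).injective.comp (Fin.castLE_injective _)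

lemma pi_map_precomp {ι κ : Type*} [Fintype ι] [Fintype κ] {E : Type*} [MeasurableSpace E]
    (ρ : Measure E) [IsProbabilityMeasure ρ] {e : ι → κ} (he : Function.Injective e) :
    (Measure.pi fun _ : κ => ρ).map (fun f i => f (e i)) = Measure.pi fun _ : ι => ρ := by
  have h : iIndepFun (fun (j : κ) (f : κ → E) => f j) (Measure.pi fun _ : κ => ρ) :=
    iIndepFun_pi (X := fun _ => id) fun _ => aemeasurable_id
  have h2 := (iIndepFun_iff_map_fun_eq_pi_map
    fun i => (measurable_pi_apply (e i)).aemeasurable).1 (h.precomp he)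
  rw [h2]
  congr 1
  funext i
  exact (measurePreserving_eval (fun _ : κ => ρ) (e i)).map_eq

lemma pi_prod_map_zip {m : ℕ} {E F : Type*} [MeasurableSpace E] [MeasurableSpace F]
    (ρ : Measure E) [IsProbabilityMeasure ρ] (ν : Measure F) [IsProbabilityMeasure ν] :
    ((Measure.pi fun _ : Fin m => ρ).prod (Measure.pi fun _ : Fin m => ν)).map
      (fun q r => (q.1 r, q.2 r)) = Measure.pi fun _ : Fin m => ρ.prod ν :=
  ((measurePreserving_arrowProdEquivProdArrow E F (Fin m) (fun _ => ρ) (fun _ => ν)).symm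
    (MeasurableEquiv.arrowProdEquivProdArrow E F (Fin m))).map_eq

lemma measurable_gather {n k : ℕ} (A : Finset (Fin k)) :
    Measurable (gather (n := n) A) := by
  unfold gather; fun_prop

lemma map_gather (α σ : ℝ) {n k : ℕ} (A : Finset (Fin k)) :
    (slotLaw α σ n k).map (gather A) = Measure.pi fun _ => symbolLaw α σ := by
  have h : gather (n := n) A =
      (fun (q : (Fin (min n A.card) → ℝ) × (Fin (min n A.card) → ℝ × ℝ)) r => (q.1 r, q.2 r)) ∘
      Prod.map id
        (fun (q : (Fin (min n A.card) → ℝ) × (Fin (min n A.card) → ℝ)) r => (q.1 r, q.2 r)) ∘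
      Prod.map (fun f (r : Fin (min n A.card)) => f (r.castLE (min_le_left _ _)))
        (Prod.map (fun f (r : Fin (min n A.card)) => f (leadPos n A r))
          (fun f (r : Fin (min n A.card)) => f (leadPos n A r))) := rfl
  rw [h, ← Measure.map_map (by fun_prop) (by fun_prop),
    ← Measure.map_map (by fun_prop) (by fun_prop), slotLaw,
    ← Measure.map_prod_map _ _ (by fun_prop) (by fun_prop),
    ← Measure.map_prod_map _ _ (by fun_prop) (by fun_prop),
    ← Measure.map_prod_map _ _ (by fun_prop) (by fun_prop),
    pi_map_precomp _ (Fin.castLE_injective _), pi_map_precomp _ (leadPos_injective n A),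
    pi_map_precomp _ (leadPos_injective n A),
    pi_prod_map_zip, Measure.map_id, pi_prod_map_zip]
  rfl

lemma activeRank_activePos (xth : ℝ) {k : ℕ} (s : Fin k → ℝ) (r : Fin (numActive xth s)) :
    activeRank xth s (activePos xth s r) = r := by
  have h : (active xth s).filter (fun i => i < activePos xth s r) =
      (Finset.Iio r).map ((active xth s).orderEmbOfFin rfl).toEmbedding := by
    ext i
    simp only [Finset.mem_filter, Finset.mem_map, Finset.mem_Iio]
    constructor
    · rintro ⟨hi, hlt⟩
      have : i ∈ Set.range ((active xth s).orderEmbOfFin rfl) := by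
        rw [Finset.range_orderEmbOfFin]; exact hi
      obtain ⟨q, rfl⟩ := this
      exact ⟨q, ((active xth s).orderEmbOfFin rfl).lt_iff_lt.1 hlt, rfl⟩
    · rintro ⟨q, hq, rfl⟩
      exact ⟨Finset.orderEmbOfFin_mem _ rfl q,
        ((active xth s).orderEmbOfFin rfl).lt_iff_lt.2 hq⟩
  rw [activeRank, h, Finset.card_map, Fin.card_Iio]

lemma abs_activePos_lt (xth : ℝ) {k : ℕ} (s : Fin k → ℝ) (r : Fin (numActive xth s)) :
    |s (activePos xth s r)| < xth :=
  (Finset.mem_filter.1 (Finset.orderEmbOfFin_mem (active xth s) rfl r)).2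

/-- In the slot in which the relay sends `s`, the codeword `x'` is jointly typical with the received
symbols that result from the source codeword, the gains and the noises `t`. -/
def SlotTypical (α σ xth : ℝ) (p : Measure ℝ) (ε : ℝ) {n k : ℕ} (s : Fin k → ℝ) (x' : Fin n → ℝ)
    (t : (Fin n → ℝ) × (Fin k → ℝ) × (Fin k → ℝ)) : Prop :=
  TypicalWith α σ xth p ε s (collect xth s (slotOutput α xth t.1 s t.2.1 t.2.2)) x'

/-- `SlotTypical` when the set of active positions is `A`. -/
def SlotTypicalOn (α σ xth : ℝ) (p : Measure ℝ) (ε : ℝ) {n k : ℕ} (A : Finset (Fin k))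
    (s : Fin k → ℝ) (x' : Fin n → ℝ) (t : (Fin n → ℝ) × (Fin k → ℝ) × (Fin k → ℝ)) : Prop :=
  JointlyTypical α σ xth p ε (fun r => s (leadPos n A r))
    (fun r => x' (r.castLE (min_le_left _ _)))
    (fun r => activeOutput α xth (s (leadPos n A r)) (gather A t r))

lemma slotTypical_iff (α σ ε : ℝ) {n k : ℕ} (s : Fin k → ℝ) (x' : Fin n → ℝ)
    (t : (Fin n → ℝ) × (Fin k → ℝ) × (Fin k → ℝ)) :
    SlotTypical α σ xth p ε s x' t ↔ SlotTypicalOn α σ xth p ε (active xth s) s x' t := by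
  have h : ∀ r : Fin (min n (numActive xth s)),
      collect xth s (slotOutput α xth t.1 s t.2.1 t.2.2) (r.castLE (min_le_right _ _)) =
        activeOutput α xth (s (leadPos n (active xth s) r)) (gather (active xth s) t r) := by
    intro r
    have hr := activeRank_activePos xth s (r.castLE (min_le_right _ _))
    have hlt : activeRank xth s (activePos xth s (r.castLE (min_le_right _ _))) < n := by
      rw [hr]; exact r.2.trans_le (min_le_left _ _)
    rw [collect, slotOutput, sourceInput, if_pos (abs_activePos_lt xth s _), dif_pos hlt,
      activeOutput]
    -- The source symbol sent in the `r`-th active position is the `r`-th symbol of the codeword.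
    have hx : (⟨activeRank xth s (activePos xth s (r.castLE (min_le_right _ _))), hlt⟩ : Fin n) =
        r.castLE (min_le_left _ _) := Fin.ext hr
    rw [hx]
    rfl
  rw [SlotTypical, TypicalWith, SlotTypicalOn]
  simp only [h]
  rfl

/-! ### Measurability of the typicality events -/

lemma measurableSet_jointlyTypical (α σ ε : ℝ) {E : Type*} [MeasurableSpace E] {m : ℕ}
    {s x y : Fin m → E → ℝ} (hs : ∀ r, Measurable (s r)) (hx : ∀ r, Measurable (x r))
    (hy : ∀ r, Measurable (y r)) :
    MeasurableSet {e | JointlyTypical α σ xth p ε (fun r => s r e) (fun r => x r e)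
      (fun r => y r e)} := by
  have m1 : ∀ r, Measurable fun e => Real.logb 2 (densX (x r e)) := by
    intro r
    have := hx r
    unfold densX gaussianPDFReal Real.logb
    fun_prop
  have m2 : ∀ r, Measurable fun e => Real.logb 2 (densY α σ xth (s r e) (y r e)) := by
    intro r
    have := hs r
    have := hy r
    unfold densY gaussianPDFReal Real.logb srcPower noiseVar
    fun_prop
  have m3 : ∀ r, Measurable fun e => Real.logb 2 (densXY α σ xth (s r e) (x r e) (y r e)) := by
    intro r
    have := hs r
    have := hy r
    have := hx r
    unfold densXY densX gaussianPDFReal Real.logb srcPower noiseVar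
    fun_prop
  have key : ∀ (c h : ℝ) (F : Fin m → E → ℝ), (∀ r, Measurable (F r)) →
      MeasurableSet {e | |c * ∑ r, F r e - h| < ε} := fun c h F hF =>
    measurableSet_lt (by fun_prop) measurable_const
  exact (key _ _ _ m1).inter ((key _ _ _ m2).inter (key _ _ _ m3))

lemma measurableSet_active_eq {k : ℕ} (A : Finset (Fin k)) :
    MeasurableSet {s : Fin k → ℝ | active xth s = A} := by
  have : {s : Fin k → ℝ | active xth s = A} = ⋂ j, {s | |s j| < xth ↔ j ∈ A} := by
    ext s
    simp [active, Finset.ext_iff]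
  rw [this]
  refine MeasurableSet.iInter fun j => ?_
  exact (measurableSet_lt (by fun_prop) measurable_const).iff (MeasurableSet.const _)

/-- The number of symbols that are compared depends on the relay codeword; the event is measurable
because it is so on each of the finitely many sets where the active positions are given. -/
lemma measurableSet_slotTypical (α σ ε : ℝ) {E : Type*} [MeasurableSpace E] {n k : ℕ}
    {s : E → Fin k → ℝ} {x' : E → Fin n → ℝ} {t : E → (Fin n → ℝ) × (Fin k → ℝ) × (Fin k → ℝ)}
    (hs : Measurable s) (hx : Measurable x') (ht : Measurable t) :
    MeasurableSet {e | SlotTypical α σ xth p ε (s e) (x' e) (t e)} := by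
  have : {e | SlotTypical α σ xth p ε (s e) (x' e) (t e)} = ⋃ A : Finset (Fin k),
      {e | active xth (s e) = A} ∩ {e | SlotTypicalOn α σ xth p ε A (s e) (x' e) (t e)} := by
    ext e
    simp [slotTypical_iff]
  rw [this]
  refine MeasurableSet.iUnion fun A => (hs (measurableSet_active_eq A)).inter ?_
  refine measurableSet_jointlyTypical α σ ε (fun r => by fun_prop) (fun r => by fun_prop)
    (fun r => ?_)
  unfold activeOutput relayOutput gather srcPower
  fun_prop

/-! ### Error events of one slot, for a fixed relay codeword -/

/-- The transmitted codeword is missed. -/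
lemma slotLaw_not_slotTypical_le {α σ ε : ℝ} [IsProbabilityMeasure p] (hα : 0 < α)
    (hσ : 0 < σ) (hτ : 0 < activeProb xth p) (hε : 0 < ε) {n k : ℕ} {s : Fin k → ℝ}
    (hm : 0 < min n (numActive xth s))
    (hst : StateTypical α σ xth p ε fun r => s (leadPos n (active xth s) r)) :
    slotLaw α σ n k {t | ¬ SlotTypical α σ xth p ε s t.1 t} ≤
      3 * ENNReal.ofReal (chiSqVar / ((min n (numActive xth s) : ℕ) * (ε / 4) ^ 2)) := by
  have h := measure_not_jointlyTypical_le hα hσ hτ hε hm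
    (fun r => abs_activePos_lt xth s _) hst
  rw [← map_gather α σ (n := n) (active xth s), Measure.map_apply (measurable_gather _)] at h
  · refine (measure_mono fun t ht => ?_).trans h
    rw [Set.mem_ofPred_eq, slotTypical_iff] at ht
    exact ht
  · refine (measurableSet_jointlyTypical α σ ε (fun r => measurable_const) (fun r => ?_)
      (fun r => ?_)).compl
    · fun_prop
    · exact (measurable_activeOutput _ _ _).comp (measurable_pi_apply r)

/-- An independent codeword is mistaken for the transmitted one. -/
lemma prod_slotLaw_slotTypical_le {α σ ε : ℝ} (hα : 0 < α) (hσ : 0 < σ) {n k : ℕ}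
    (s : Fin k → ℝ) :
    ((Measure.pi fun _ : Fin n => gaussianReal 0 1).prod (slotLaw α σ n k))
      {q | SlotTypical α σ xth p ε s q.1 q.2} ≤
      ENNReal.ofReal ((2 : ℝ) ^
        (-(((min n (numActive xth s) : ℕ) : ℝ) * (activeInfo α σ xth p - 3 * ε)))) := by
  rw [Measure.prod_apply_symm (measurableSet_slotTypical α σ ε measurable_const measurable_fst
    measurable_snd)]
  refine (lintegral_mono fun t => ?_).trans (lintegral_const _ |>.trans_le
    (by rw [measure_univ, mul_one]))
  have h := measure_jointlyTypical_indep_le (p := p) (xth := xth) (ε := ε) hα hσ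
    (fun r : Fin (min n (numActive xth s)) => s (leadPos n (active xth s) r))
    (fun r => activeOutput α xth (s (leadPos n (active xth s) r)) (gather (active xth s) t r))
  rw [← pi_map_precomp (gaussianReal 0 1)
    (Fin.castLE_injective (min_le_left n (numActive xth s))),
    Measure.map_apply (by fun_prop)] at h
  · refine (measure_mono fun x hx => ?_).trans h
    exact (slotTypical_iff α σ ε s x t).1 hx
  · exact measurableSet_jointlyTypical α σ ε (fun r => measurable_const)
      (fun r => measurable_pi_apply r) (fun r => measurable_const)

/-! ### Relay codewords with typical empirical means -/

/-- Relay codewords whose number of active positions, and whose sum of `stateEnt` over the active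
positions, deviate from their means by at most `k η`. -/
def goodRelay (α σ xth : ℝ) (p : Measure ℝ) (η : ℝ) (k : ℕ) : Set (Fin k → ℝ) :=
  {s | |∑ j, {x : ℝ | |x| < xth}.indicator (fun _ => (1 : ℝ)) (s j) - k * activeProb xth p| ≤
      k * η} ∩
  {s | |∑ j, {x : ℝ | |x| < xth}.indicator (stateEnt α σ) (s j) -
      k * (activeProb xth p * meanStateEnt α σ xth p)| ≤ k * η}

lemma measurable_indicator_active {f : ℝ → ℝ} (hf : Measurable f) :
    Measurable ({x : ℝ | |x| < xth}.indicator f) :=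
  hf.indicator (measurableSet_abs_lt xth)

lemma measurableSet_goodRelay (α σ η : ℝ) (k : ℕ) :
    MeasurableSet (goodRelay α σ xth p η k) := by
  have key : ∀ (c : ℝ) (f : ℝ → ℝ), Measurable f →
      MeasurableSet {s : Fin k → ℝ |
        |∑ j, {x : ℝ | |x| < xth}.indicator f (s j) - c| ≤ k * η} := by
    intro c f hf
    have := measurable_indicator_active (xth := xth) hf
    exact measurableSet_le (by fun_prop) measurable_const
  exact (key _ _ measurable_const).inter (key _ _ (measurable_stateEnt α σ))

/-- Variance of `f(X_R)`, set to zero at inactive relay symbols, for `X_R ∼ p`. -/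
def relayVar (xth : ℝ) (p : Measure ℝ) (f : ℝ → ℝ) : ℝ := Var[{x : ℝ | |x| < xth}.indicator f; p]

lemma measure_compl_goodRelay_le {α σ η : ℝ} [IsProbabilityMeasure p] (hα : 0 < α) (hσ : 0 < σ)
    (hτ : 0 < activeProb xth p) (hη : 0 < η) {k : ℕ} (hk : 0 < k) :
    (Measure.pi fun _ : Fin k => p) (goodRelay α σ xth p η k)ᶜ ≤
      ENNReal.ofReal (relayVar xth p (fun _ => 1) / (k * η ^ 2)) +
        ENNReal.ofReal (relayVar xth p (stateEnt α σ) / (k * η ^ 2)) := by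
  have key : ∀ (f : ℝ → ℝ) (C : ℝ), Measurable f → (∀ x, |x| < xth → |f x| ≤ C) →
      (Measure.pi fun _ : Fin k => p)
        {s | k * η ≤ |∑ j, {x : ℝ | |x| < xth}.indicator f (s j) -
          k * (activeProb xth p * ∫ x, f x ∂(activeLaw xth p))|} ≤
        ENNReal.ofReal (relayVar xth p f / (k * η ^ 2)) := by
    intro f C hf hC
    refine chebyshev_pi hk (fun _ => {x : ℝ | |x| < xth}.indicator f) (fun _ => ?_) (fun _ => ?_)
      (fun _ => le_rfl) hη
    · refine MemLp.of_bound (measurable_indicator_active hf).aestronglyMeasurable (max C 0)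
        (ae_of_all _ fun x => ?_)
      by_cases hx : |x| < xth
      · rw [Set.indicator_of_mem (by exact hx), Real.norm_eq_abs]
        exact (hC x hx).trans (le_max_left _ _)
      · rw [Set.indicator_of_notMem (by exact hx), norm_zero]
        exact le_max_right _ _
    · rw [integral_indicator (measurableSet_abs_lt xth), activeProb_mul_integral_activeLaw hτ]
  have := isProbabilityMeasure_activeLaw hτ
  have h1 := key (fun _ => 1) 1 measurable_const (fun _ _ => by simp)
  have h2 := key (stateEnt α σ) _ (measurable_stateEnt α σ) (fun x hx => abs_stateEnt_le hα hσ hx)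
  rw [integral_const, probReal_univ, one_smul, mul_one] at h1
  refine (measure_mono fun s hs => ?_).trans ((measure_union_le _ _).trans (add_le_add h1 h2))
  rw [goodRelay, Set.compl_inter] at hs
  rcases hs with hs | hs
  · rw [Set.mem_compl_iff, Set.mem_ofPred_eq, not_le] at hs
    exact Or.inl hs.le
  · rw [Set.mem_compl_iff, Set.mem_ofPred_eq, not_le] at hs
    exact Or.inr hs.le

lemma abs_sum_sub_sum_leadPos_le {n k : ℕ} (A : Finset (Fin k)) (f : Fin k → ℝ) {C : ℝ}
    (hC : ∀ j ∈ A, |f j| ≤ C) :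
    |∑ j ∈ A, f j - ∑ r, f (leadPos n A r)| ≤ ((A.card : ℝ) - (min n A.card : ℕ)) * C := by
  set L : Finset (Fin k) := Finset.univ.map ⟨leadPos n A, leadPos_injective n A⟩ with hL
  have hLA : L ⊆ A := by
    intro j hj
    obtain ⟨r, -, rfl⟩ := Finset.mem_map.1 hj
    exact Finset.orderEmbOfFin_mem A rfl _
  have hsum : ∑ r, f (leadPos n A r) = ∑ j ∈ L, f j := by
    rw [hL, Finset.sum_map]
    rfl
  have hcard : L.card = min n A.card := by rw [hL, Finset.card_map, Finset.card_fin]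
  rw [hsum, ← Finset.sum_sdiff hLA, add_sub_cancel_right]
  refine (Finset.abs_sum_le_sum_abs _ _).trans ?_
  refine (Finset.sum_le_sum fun j hj => hC j (Finset.mem_sdiff.1 hj).1).trans ?_
  rw [Finset.sum_const, Finset.card_sdiff_of_subset hLA, hcard, nsmul_eq_mul,
    Nat.cast_sub (min_le_right _ _)]

/-- For a good relay codeword, the number of transmitted codeword symbols is `k p_T` up to `k η`,
and the relay symbols in these positions have a typical mean of `stateEnt`. -/
lemma bounds_of_mem_goodRelay {α σ η : ℝ} [IsProbabilityMeasure p] (hα : 0 < α) (hσ : 0 < σ)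
    {k : ℕ} (hk : 1 ≤ k * η) {s : Fin k → ℝ}
    (hs : s ∈ goodRelay α σ xth p η k) {m : ℕ}
    (hm : m = min (codewordLength xth p k) (numActive xth s)) :
    k * activeProb xth p - k * η ≤ m ∧ (m : ℝ) ≤ k * activeProb xth p ∧
    |∑ r, stateEnt α σ (s (leadPos (codewordLength xth p k) (active xth s) r)) -
      m * meanStateEnt α σ xth p| ≤
      k * η * (2 * stateEntBound α σ xth + 1 + |meanStateEnt α σ xth p|) := by
  obtain ⟨h1, h2⟩ := hs
  rw [Set.mem_ofPred_eq] at h1 h2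
  set τ := activeProb xth p with hτ
  set e := meanStateEnt α σ xth p
  set n := codewordLength xth p k with hn
  set C := stateEntBound α σ xth
  have hτ0 : 0 ≤ k * τ := mul_nonneg (Nat.cast_nonneg _) measureReal_nonneg
  have hind : ∀ f : ℝ → ℝ, ∑ j, {x : ℝ | |x| < xth}.indicator f (s j) =
      ∑ j ∈ active xth s, f (s j) := by
    intro f
    rw [active, Finset.sum_filter]
    rfl
  rw [hind] at h1 h2
  rw [Finset.sum_const, nsmul_eq_mul, mul_one] at h1
  have h1a := (abs_le.1 h1).1
  have h1b := (abs_le.1 h1).2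
  have hnle : (n : ℝ) ≤ k * τ := Nat.floor_le hτ0
  have hnlt : k * τ < n + 1 := Nat.lt_floor_add_one _
  have hmn : (m : ℝ) ≤ n := by rw [hm]; exact_mod_cast min_le_left _ _
  -- Rounding `k p_T` down costs at most `1 ≤ k η`, the same as the deviation allowed for `T`.
  have hlow : k * τ - k * η ≤ m := by
    rw [hm, Nat.cast_min, le_min_iff]
    constructor <;> linarith
  have hup : (m : ℝ) ≤ k * τ := hmn.trans hnle
  refine ⟨hlow, hup, ?_⟩
  have hlead := abs_sum_sub_sum_leadPos_le (n := n) (active xth s) (fun j => stateEnt α σ (s j))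
    (C := C) fun j hj => abs_stateEnt_le hα hσ (Finset.mem_filter.1 hj).2
  have hC : 0 ≤ C := (abs_nonneg _).trans (le_max_left _ _)
  have hA : (((active xth s).card : ℝ) - (min n (active xth s).card : ℕ)) * C ≤
      2 * (k * η) * C := by
    refine mul_le_mul_of_nonneg_right ?_ hC
    have : ((min n (active xth s).card : ℕ) : ℝ) = m := by rw [hm]
    rw [this]
    linarith
  have he : |(k * τ - m) * e| ≤ k * η * |e| := by
    rw [abs_mul, abs_of_nonneg (by linarith)]
    exact mul_le_mul_of_nonneg_right (by linarith) (abs_nonneg _)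
  have hlead' := hlead.trans hA
  generalize ∑ r, stateEnt α σ (s (leadPos n (active xth s) r)) = S at *
  generalize ∑ j ∈ active xth s, stateEnt α σ (s j) = S' at *
  have hsplit : S - m * e = -(S' - S) + (S' - k * (τ * e)) + (k * τ - m) * e := by ring
  rw [hsplit]
  refine (abs_add_three _ _ _).trans ?_
  rw [abs_neg]
  linarith

/-! ### The decoding error of one slot -/

lemma relayDecode_ne_some {α σ ε : ℝ} {M n k : ℕ} {cS : Fin M → Fin n → ℝ} {xR : Fin k → ℝ}
    {yR : Fin (numActive xth xR) → ℝ} {c : Fin M}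
    (h : relayDecode α σ xth p ε cS xR yR ≠ some c) :
    ¬ TypicalWith α σ xth p ε xR yR (cS c) ∨
      ∃ w ∈ Finset.univ.erase c, TypicalWith α σ xth p ε xR yR (cS w) := by
  by_contra! hcon
  obtain ⟨hc, hw⟩ := hcon
  have huniq : ∀ w, TypicalWith α σ xth p ε xR yR (cS w) → w = c := by
    intro w hwt
    by_contra hne
    exact hw w (Finset.mem_erase.2 ⟨hne, Finset.mem_univ _⟩) hwt
  have hex : ∃! w, TypicalWith α σ xth p ε xR yR (cS w) := ⟨c, hc, huniq⟩
  apply h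
  rw [relayDecode, dif_pos hex, huniq _ hex.exists.choose_spec]

/-- Law of the codebooks, the gains and the noises. -/
def codeLaw (α σ : ℝ) (p : Measure ℝ) (B M n k : ℕ) :
    Measure ((Fin M → Fin n → ℝ) × (Fin M → Fin k → ℝ) ×
      (Fin B → Fin k → ℝ) × (Fin B → Fin k → ℝ)) :=
  (Measure.pi fun _ => Measure.pi fun _ => gaussianReal 0 1).prod
    ((Measure.pi fun _ => Measure.pi fun _ => p).prod
      ((Measure.pi fun _ => Measure.pi fun _ => gainLaw α).prod
        (Measure.pi fun _ => Measure.pi fun _ => noiseLaw σ)))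

instance (α σ : ℝ) [IsProbabilityMeasure p] (B M n k : ℕ) :
    IsProbabilityMeasure (codeLaw α σ p B M n k) := by
  unfold codeLaw; infer_instance

lemma measurePreserving_prod_left_comm {X Y Z : Type*} [MeasurableSpace X] [MeasurableSpace Y]
    [MeasurableSpace Z] (μ : Measure X) (ν : Measure Y) (ρ : Measure Z) [SFinite μ] [SFinite ν]
    [SFinite ρ] :
    MeasurePreserving (fun q : X × Y × Z => (q.2.1, q.1, q.2.2)) (μ.prod (ν.prod ρ))
      (ν.prod (μ.prod ρ)) :=
  (measurePreserving_prodAssoc ν μ ρ).comp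
    (((Measure.measurePreserving_swap (μ := μ) (ν := ν)).prod (MeasurePreserving.id ρ)).comp
      ((measurePreserving_prodAssoc μ ν ρ).symm MeasurableEquiv.prodAssoc))

lemma measurePreserving_eval_pair {ι E : Type*} [Fintype ι] [MeasurableSpace E] (ρ : Measure E)
    [IsProbabilityMeasure ρ] {i j : ι} (hij : i ≠ j) :
    MeasurePreserving (fun f : ι → E => (f i, f j)) (Measure.pi fun _ => ρ) (ρ.prod ρ) := by
  refine ⟨by fun_prop, ?_⟩
  have h : iIndepFun (fun (j : ι) (f : ι → E) => f j) (Measure.pi fun _ : ι => ρ) :=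
    iIndepFun_pi (X := fun _ => id) fun _ => aemeasurable_id
  have h2 := (indepFun_iff_map_prod_eq_prod_map_map (measurable_pi_apply i).aemeasurable
    (measurable_pi_apply j).aemeasurable).1
    (h.indepFun hij)
  rw [h2]
  congr 1
  · exact (measurePreserving_eval (fun _ : ι => ρ) i).map_eq
  · exact (measurePreserving_eval (fun _ : ι => ρ) j).map_eq

lemma measurePreserving_transmitted (α σ : ℝ) [IsProbabilityMeasure p] {B M n k : ℕ}
    (a c : Fin M) (i : Fin B) :
    MeasurePreserving (fun ω : (Fin M → Fin n → ℝ) × (Fin M → Fin k → ℝ) ×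
      (Fin B → Fin k → ℝ) × (Fin B → Fin k → ℝ) => (ω.2.1 a, ω.1 c, ω.2.2.1 i, ω.2.2.2 i))
      (codeLaw α σ p B M n k) ((Measure.pi fun _ => p).prod (slotLaw α σ n k)) :=
  (measurePreserving_prod_left_comm _ _ _).comp
    ((measurePreserving_eval _ c).prod ((measurePreserving_eval _ a).prod
      ((measurePreserving_eval _ i).prod (measurePreserving_eval _ i))))

lemma measurePreserving_other (α σ : ℝ) [IsProbabilityMeasure p] {B M n k : ℕ}
    (a : Fin M) {w c : Fin M} (hw : w ≠ c) (i : Fin B) :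
    MeasurePreserving (fun ω : (Fin M → Fin n → ℝ) × (Fin M → Fin k → ℝ) ×
      (Fin B → Fin k → ℝ) × (Fin B → Fin k → ℝ) =>
        (ω.2.1 a, ω.1 w, ω.1 c, ω.2.2.1 i, ω.2.2.2 i))
      (codeLaw α σ p B M n k) ((Measure.pi fun _ => p).prod
        ((Measure.pi fun _ : Fin n => gaussianReal 0 1).prod (slotLaw α σ n k))) :=
  ((MeasurePreserving.id (Measure.pi fun _ : Fin k => p)).prod
    (measurePreserving_prodAssoc (Measure.pi fun _ : Fin n => gaussianReal 0 1)
      (Measure.pi fun _ : Fin n => gaussianReal 0 1)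
      ((Measure.pi fun _ : Fin k => gainLaw α).prod
        (Measure.pi fun _ : Fin k => noiseLaw σ)))).comp
    ((measurePreserving_prod_left_comm _ _ _).comp
      ((measurePreserving_eval_pair (Measure.pi fun _ : Fin n => gaussianReal 0 1) hw).prod
        ((measurePreserving_eval (fun _ => Measure.pi fun _ => p) a).prod
          ((measurePreserving_eval (fun _ => Measure.pi fun _ => gainLaw α) i).prod
            (measurePreserving_eval (fun _ => Measure.pi fun _ => noiseLaw σ) i)))))

lemma measure_prod_le_of_forall_section {X Y : Type*} [MeasurableSpace X] [MeasurableSpace Y]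
    {μ : Measure X} [IsProbabilityMeasure μ] {ν : Measure Y} [SFinite ν] {S : Set (X × Y)}
    (hS : MeasurableSet S) {G : Set X} (hG : MeasurableSet G) {δ : ℝ≥0∞}
    (h : ∀ a ∈ G, ν (Prod.mk a ⁻¹' S) ≤ δ) : μ.prod ν (Prod.fst ⁻¹' G ∩ S) ≤ δ := by
  rw [Measure.prod_apply ((measurable_fst hG).inter hS)]
  refine (lintegral_mono fun a => ?_).trans
    ((lintegral_const δ).trans_le (by rw [measure_univ, mul_one]))
  by_cases ha : a ∈ G
  · exact (measure_mono fun b hb => hb.2).trans (h a ha)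
  · have : Prod.mk a ⁻¹' (Prod.fst ⁻¹' G ∩ S) = ∅ := by
      ext b
      simp [ha]
    rw [this, measure_empty]
    exact zero_le

/-- Union bound for one slot: the relay codeword is bad, or the transmitted codeword is missed, or
one of the other codewords is jointly typical. -/
lemma codeLaw_slotError_le {α σ ε : ℝ} [IsProbabilityMeasure p] {B M n k : ℕ}
    {G : Set (Fin k → ℝ)} (hG : MeasurableSet G) {δ₁ δ₂ : ℝ≥0∞}
    (h1 : ∀ s ∈ G, slotLaw α σ n k {t | ¬ SlotTypical α σ xth p ε s t.1 t} ≤ δ₁)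
    (h2 : ∀ s ∈ G, ((Measure.pi fun _ : Fin n => gaussianReal 0 1).prod (slotLaw α σ n k))
      {q | SlotTypical α σ xth p ε s q.1 q.2} ≤ δ₂) (a c : Fin M) (i : Fin B) :
    codeLaw α σ p B M n k {ω | relayDecode α σ xth p ε ω.1 (ω.2.1 a) (collect xth (ω.2.1 a)
      (slotOutput α xth (ω.1 c) (ω.2.1 a) (ω.2.2.1 i) (ω.2.2.2 i))) ≠ some c} ≤
      (Measure.pi fun _ : Fin k => p) Gᶜ + (δ₁ + ((M - 1 : ℕ) : ℝ≥0∞) * δ₂) := by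
  -- Each of the three parts is the preimage of a measurable set under a measure preserving map, so
  -- its measure can be computed section by section, for a fixed relay codeword.
  set bad := (fun ω : (Fin M → Fin n → ℝ) × (Fin M → Fin k → ℝ) ×
      (Fin B → Fin k → ℝ) × (Fin B → Fin k → ℝ) => (ω.2.1 a, ω.1 c, ω.2.2.1 i, ω.2.2.2 i)) ⁻¹'
        (Prod.fst ⁻¹' Gᶜ) with hbad
  set miss := (fun ω : (Fin M → Fin n → ℝ) × (Fin M → Fin k → ℝ) ×
      (Fin B → Fin k → ℝ) × (Fin B → Fin k → ℝ) => (ω.2.1 a, ω.1 c, ω.2.2.1 i, ω.2.2.2 i)) ⁻¹'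
        (Prod.fst ⁻¹' G ∩ {q | ¬ SlotTypical α σ xth p ε q.1 q.2.1 q.2}) with hmiss
  set other := fun w : Fin M => (fun ω : (Fin M → Fin n → ℝ) × (Fin M → Fin k → ℝ) ×
      (Fin B → Fin k → ℝ) × (Fin B → Fin k → ℝ) =>
        (ω.2.1 a, ω.1 w, ω.1 c, ω.2.2.1 i, ω.2.2.2 i)) ⁻¹'
        (Prod.fst ⁻¹' G ∩ {q | SlotTypical α σ xth p ε q.1 q.2.1 q.2.2}) with hother
  have hmt := measurePreserving_transmitted (p := p) α σ (n := n) (k := k) a c i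
  have hbad_le : codeLaw α σ p B M n k bad ≤ (Measure.pi fun _ : Fin k => p) Gᶜ := by
    rw [hbad, hmt.measure_preimage (measurable_fst hG.compl).nullMeasurableSet]
    have := Measure.fst_prod (μ := Measure.pi fun _ : Fin k => p) (ν := slotLaw α σ n k)
    rw [← this, Measure.fst_apply hG.compl, this]
  have hSm : MeasurableSet {q : (Fin k → ℝ) × (Fin n → ℝ) × (Fin k → ℝ) × (Fin k → ℝ) |
      ¬ SlotTypical α σ xth p ε q.1 q.2.1 q.2} :=
    (measurableSet_slotTypical α σ ε (by fun_prop) (by fun_prop) (by fun_prop)).compl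
  have hmiss_le : codeLaw α σ p B M n k miss ≤ δ₁ := by
    rw [hmiss, hmt.measure_preimage ((measurable_fst hG).inter hSm).nullMeasurableSet]
    exact measure_prod_le_of_forall_section hSm hG h1
  have hSo : MeasurableSet {q : (Fin k → ℝ) × (Fin n → ℝ) × (Fin n → ℝ) × (Fin k → ℝ) ×
      (Fin k → ℝ) | SlotTypical α σ xth p ε q.1 q.2.1 q.2.2} :=
    measurableSet_slotTypical α σ ε (by fun_prop) (by fun_prop) (by fun_prop)
  have hother_le : ∀ w ∈ Finset.univ.erase c, codeLaw α σ p B M n k (other w) ≤ δ₂ := by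
    intro w hw
    have hmo := measurePreserving_other (p := p) α σ (n := n) (k := k) a
      (Finset.ne_of_mem_erase hw) i
    rw [hother]
    beta_reduce
    rw [hmo.measure_preimage ((measurable_fst hG).inter hSo).nullMeasurableSet]
    exact measure_prod_le_of_forall_section hSo hG h2
  have hcover : {ω | relayDecode α σ xth p ε ω.1 (ω.2.1 a) (collect xth (ω.2.1 a)
      (slotOutput α xth (ω.1 c) (ω.2.1 a) (ω.2.2.1 i) (ω.2.2.2 i))) ≠ some c} ⊆
      bad ∪ (miss ∪ ⋃ w ∈ Finset.univ.erase c, other w) := by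
    intro ω hω
    by_cases hg : ω.2.1 a ∈ G
    · refine Or.inr ?_
      rcases relayDecode_ne_some hω with h | ⟨w, hw, h⟩
      · exact Or.inl ⟨hg, h⟩
      · exact Or.inr (Set.mem_iUnion₂.2 ⟨w, hw, hg, h⟩)
    · exact Or.inl hg
  refine (measure_mono hcover).trans ((measure_union_le _ _).trans (add_le_add hbad_le
    ((measure_union_le _ _).trans (add_le_add hmiss_le ?_))))
  refine (measure_biUnion_finset_le _ _).trans ((Finset.sum_le_sum hother_le).trans ?_)
  rw [Finset.sum_const, Finset.card_erase_of_mem (Finset.mem_univ c), Finset.card_univ,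
    Fintype.card_fin, nsmul_eq_mul]

/-- Union bound over the slots; the messages are averaged out. -/
lemma schemeLaw_relayError_le {α σ ε : ℝ} [IsProbabilityMeasure p] {B M n k : ℕ} (hM : 0 < M)
    {δ : ℝ≥0∞}
    (h : ∀ (a c : Fin M) (i : Fin B), codeLaw α σ p B M n k
      {ω | relayDecode α σ xth p ε ω.1 (ω.2.1 a) (collect xth (ω.2.1 a)
        (slotOutput α xth (ω.1 c) (ω.2.1 a) (ω.2.2.1 i) (ω.2.2.2 i))) ≠ some c} ≤ δ) :
    schemeLaw α σ p B M n k
      {ω | RelayError α σ xth p ε ⟨ω.1, ω.2.1, ω.2.2.1, ω.2.2.2.1, ω.2.2.2.2⟩} ≤ B * δ := by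
  have : NeZero M := ⟨hM.ne'⟩
  have hU : IsProbabilityMeasure (uniformOn (Set.univ : Set (Fin M))) :=
    isProbabilityMeasure_uniformOn Set.finite_univ Set.univ_nonempty
  set U : Measure (Fin B → Fin M) := Measure.pi fun _ => uniformOn Set.univ with hUdef
  have hscheme : schemeLaw α σ p B M n k = U.prod (codeLaw α σ p B M n k) := rfl
  set E : (Fin B → Fin M) → Fin B → Set ((Fin M → Fin n → ℝ) × (Fin M → Fin k → ℝ) ×
      (Fin B → Fin k → ℝ) × (Fin B → Fin k → ℝ)) := fun msg i =>
    {ω | relayDecode α σ xth p ε ω.1 (ω.2.1 (msg ⟨i - 1, by omega⟩))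
      (collect xth (ω.2.1 (msg ⟨i - 1, by omega⟩))
        (slotOutput α xth (ω.1 (msg i)) (ω.2.1 (msg ⟨i - 1, by omega⟩)) (ω.2.2.1 i)
          (ω.2.2.2 i))) ≠ some (msg i)} with hE
  -- The error event is covered by rectangles, one for each message sequence: the measure of a
  -- rectangle is known without measurability of its sides.
  have hcover : {ω | RelayError α σ xth p ε ⟨ω.1, ω.2.1, ω.2.2.1, ω.2.2.2.1, ω.2.2.2.2⟩} ⊆
      ⋃ msg ∈ (Finset.univ : Finset (Fin B → Fin M)), {msg} ×ˢ ⋃ i, E msg i := by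
    rintro ⟨msg, ω⟩ ⟨b, h2, hB, hne⟩
    refine Set.mem_iUnion₂.2 ⟨msg, Finset.mem_univ _, rfl, Set.mem_iUnion.2 ⟨⟨b - 1, by omega⟩, ?_⟩⟩
    exact hne
  rw [hscheme]
  refine (measure_mono hcover).trans ((measure_biUnion_finset_le _ _).trans ?_)
  calc ∑ msg, (U.prod (codeLaw α σ p B M n k)) ({msg} ×ˢ ⋃ i, E msg i)
      ≤ ∑ msg : Fin B → Fin M, U {msg} * (B * δ) := by
        refine Finset.sum_le_sum fun msg _ => ?_
        rw [Measure.prod_prod]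
        refine mul_le_mul_right ?_ _
        refine (measure_iUnion_fintype_le _ _).trans
          ((Finset.sum_le_sum fun i _ => h _ _ i).trans_eq ?_)
        rw [Finset.sum_const, Finset.card_univ, Fintype.card_fin, nsmul_eq_mul]
    _ = B * δ := by
        rw [← Finset.sum_mul, sum_measure_singleton, Finset.coe_univ, measure_univ, one_mul]

/-! ### The error probability for growing slot length -/

lemma numMessages_pos (R : ℝ) (k : ℕ) : 0 < numMessages R k :=
  Nat.ceil_pos.2 (by positivity)

lemma numMessages_sub_one_le (R : ℝ) (k : ℕ) :
    ((numMessages R k - 1 : ℕ) : ℝ) ≤ 2 ^ ((k : ℝ) * R) := by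
  have h := Nat.ceil_lt_add_one (a := (2 : ℝ) ^ ((k : ℝ) * R)) (by positivity)
  rw [Nat.cast_sub (numMessages_pos R k), Nat.cast_one]
  exact (sub_lt_iff_lt_add.2 h).le

lemma tendsto_ofReal_div_natCast_mul (a b : ℝ) :
    Tendsto (fun k : ℕ => ENNReal.ofReal (a / (k * b))) atTop (𝓝 0) := by
  have h : Tendsto (fun k : ℕ => a / b / (k : ℝ)) atTop (𝓝 0) :=
    tendsto_const_div_atTop_nhds_zero_nat _
  rw [← ENNReal.ofReal_zero]
  refine (ENNReal.continuous_ofReal.tendsto 0).comp (h.congr fun k => ?_)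
  rw [div_div, mul_comm]

lemma tendsto_ofReal_two_rpow_neg {c : ℝ} (hc : 0 < c) :
    Tendsto (fun k : ℕ => ENNReal.ofReal ((2 : ℝ) ^ (-(k * c)))) atTop (𝓝 0) := by
  have h : Tendsto (fun k : ℕ => ((2 : ℝ) ^ (-c)) ^ k) atTop (𝓝 0) :=
    tendsto_pow_atTop_nhds_zero_of_lt_one (by positivity)
      (Real.rpow_lt_one_of_one_lt_of_neg one_lt_two (neg_lt_zero.2 hc))
  rw [← ENNReal.ofReal_zero]
  refine (ENNReal.continuous_ofReal.tendsto 0).comp (h.congr fun k => ?_)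
  rw [← Real.rpow_natCast, ← Real.rpow_mul two_pos.le]
  congr 1
  ring

/-- Explicit bound on the error probability. Here `η` is the tolerance for the relay codewords and
`2 c` is the gap between the rate and the exponent `p_T (I(X; Y | S) - 3 ε)`. -/
lemma errorProb_le {α σ R ε η c : ℝ} [IsProbabilityMeasure p] (hα : 0 < α) (hσ : 0 < σ)
    (hτ : 0 < activeProb xth p) (hε : 0 < ε) (hη : 0 < η)
    (hη1 : η ≤ activeProb xth p / 2)
    (hη2 : η * (2 * stateEntBound α σ xth + 1 + |meanStateEnt α σ xth p|) ≤
      activeProb xth p * ε / 4)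
    (hη3 : η * |activeInfo α σ xth p - 3 * ε| ≤ c)
    (hR : R + 2 * c = activeProb xth p * (activeInfo α σ xth p - 3 * ε))
    (B : ℕ) {k : ℕ} (hk : 1 ≤ k * η) :
    errorProb α σ xth p R ε B k ≤ B *
      (ENNReal.ofReal (relayVar xth p (fun _ => 1) / (k * η ^ 2)) +
        ENNReal.ofReal (relayVar xth p (stateEnt α σ) / (k * η ^ 2)) +
        (3 * ENNReal.ofReal (chiSqVar / (k * (activeProb xth p / 2 * (ε / 4) ^ 2))) +
          ENNReal.ofReal ((2 : ℝ) ^ (-(k * c))))) := by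
  set τ := activeProb xth p with hτdef
  set J := activeInfo α σ xth p - 3 * ε with hJ
  have hk0 : 0 < k := by
    rcases Nat.eq_zero_or_pos k with rfl | h
    · norm_num at hk
    · exact h
  have hk' : (0 : ℝ) < k := Nat.cast_pos.2 hk0
  set n := codewordLength xth p k with hn
  have hlow : ∀ s ∈ goodRelay α σ xth p η k,
      (k : ℝ) * (τ / 2) ≤ (min n (numActive xth s) : ℕ) := by
    intro s hs
    refine le_trans ?_ (bounds_of_mem_goodRelay hα hσ hk hs rfl).1
    nlinarith
  have h1 : ∀ s ∈ goodRelay α σ xth p η k,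
      slotLaw α σ n k {t | ¬ SlotTypical α σ xth p ε s t.1 t} ≤
        3 * ENNReal.ofReal (chiSqVar / (k * (τ / 2 * (ε / 4) ^ 2))) := by
    intro s hs
    obtain ⟨-, -, hmean⟩ := bounds_of_mem_goodRelay hα hσ hk hs rfl
    have hl := hlow s hs
    have hmpos : (0 : ℝ) < (min n (numActive xth s) : ℕ) :=
      (mul_pos hk' (half_pos hτ)).trans_le hl
    refine (slotLaw_not_slotTypical_le hα hσ hτ hε (Nat.cast_pos.1 hmpos) ?_).trans ?_
    · refine hmean.trans ?_
      calc (k : ℝ) * η * (2 * stateEntBound α σ xth + 1 + |meanStateEnt α σ xth p|)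
          ≤ k * (τ * ε / 4) := by rw [mul_assoc]; gcongr
        _ = k * (τ / 2) * (ε / 2) := by ring
        _ ≤ _ := by gcongr
    · gcongr 3 * ENNReal.ofReal ?_
      refine div_le_div_of_nonneg_left (variance_nonneg _ _) (by positivity) ?_
      rw [← mul_assoc]
      gcongr
  have h2 : ∀ s ∈ goodRelay α σ xth p η k,
      ((Measure.pi fun _ : Fin n => gaussianReal 0 1).prod (slotLaw α σ n k))
        {q | SlotTypical α σ xth p ε s q.1 q.2} ≤
        ENNReal.ofReal ((2 : ℝ) ^ (-(k * (R + c)))) := by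
    intro s hs
    refine (prod_slotLaw_slotTypical_le hα hσ s).trans (ENNReal.ofReal_le_ofReal ?_)
    refine Real.rpow_le_rpow_of_exponent_le one_le_two (neg_le_neg ?_)
    obtain ⟨ha, hb, -⟩ := bounds_of_mem_goodRelay hα hσ hk hs rfl
    rw [← hJ]
    -- `J` is negative when `R` is very small, so the deviation of `m` is weighted by `|J|`.
    have habs : (k * τ - (min n (numActive xth s) : ℕ)) * J ≤ k * c := by
      calc (k * τ - (min n (numActive xth s) : ℕ)) * J
          ≤ (k * τ - (min n (numActive xth s) : ℕ)) * |J| :=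
            mul_le_mul_of_nonneg_left (le_abs_self J) (by linarith)
        _ ≤ k * η * |J| := mul_le_mul_of_nonneg_right (by linarith) (abs_nonneg J)
        _ ≤ k * c := by rw [mul_assoc]; gcongr
    have hRk : (k : ℝ) * (R + 2 * c) = k * (τ * J) := by rw [hR]
    nlinarith
  have hslot := fun a c i => codeLaw_slotError_le (B := B) (M := numMessages R k)
    (measurableSet_goodRelay α σ η k) h1 h2 a c i
  refine (schemeLaw_relayError_le (numMessages_pos R k) hslot).trans ?_
  gcongr
  · exact measure_compl_goodRelay_le hα hσ hτ hη hk0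
  · rw [← ENNReal.ofReal_natCast, ← ENNReal.ofReal_mul (Nat.cast_nonneg _)]
    refine ENNReal.ofReal_le_ofReal ?_
    refine (mul_le_mul_of_nonneg_right (numMessages_sub_one_le R k) (by positivity)).trans_eq ?_
    rw [← Real.rpow_add two_pos]
    congr 1
    ring

lemma tendsto_errorProb {α σ R ε : ℝ} [IsProbabilityMeasure p] (hα : 0 < α) (hσ : 0 < σ)
    (hτ : 0 < activeProb xth p) (hε : 0 < ε)
    (hR : R < activeProb xth p * (activeInfo α σ xth p - 3 * ε)) (B : ℕ) :
    Tendsto (fun k : ℕ => errorProb α σ xth p R ε B k) atTop (𝓝 0) := by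
  set τ := activeProb xth p with hτdef
  set J := activeInfo α σ xth p - 3 * ε with hJ
  set Q := 2 * stateEntBound α σ xth + 1 + |meanStateEnt α σ xth p| with hQ
  obtain ⟨c, hcdef⟩ : ∃ c, c = (τ * J - R) / 2 := ⟨_, rfl⟩
  have hc : 0 < c := by rw [hcdef]; linarith
  have hQ0 : 0 < Q := by
    have : 0 ≤ stateEntBound α σ xth := (abs_nonneg _).trans (le_max_left _ _)
    positivity
  obtain ⟨η, hη, h1, h2, h3⟩ : ∃ η, 0 < η ∧ η ≤ τ / 2 ∧ η * Q ≤ τ * ε / 4 ∧ η * |J| ≤ c := by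
    have hJ0 : 0 < |J| + 1 := by positivity
    refine ⟨min (τ / 2) (min (τ * ε / 4 / Q) (c / (|J| + 1))), by positivity,
      min_le_left _ _, ?_, ?_⟩
    · rw [← le_div_iff₀ hQ0]
      exact (min_le_right _ _).trans (min_le_left _ _)
    · refine (mul_le_mul_of_nonneg_right ((min_le_right _ _).trans (min_le_right _ _))
        (abs_nonneg J)).trans ?_
      rw [div_mul_eq_mul_div, div_le_iff₀ hJ0]
      nlinarith
  have hlim : Tendsto (fun k : ℕ => (B : ℝ≥0∞) *
      (ENNReal.ofReal (relayVar xth p (fun _ => 1) / (k * η ^ 2)) +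
        ENNReal.ofReal (relayVar xth p (stateEnt α σ) / (k * η ^ 2)) +
        (3 * ENNReal.ofReal (chiSqVar / (k * (τ / 2 * (ε / 4) ^ 2))) +
          ENNReal.ofReal ((2 : ℝ) ^ (-(k * c)))))) atTop (𝓝 0) := by
    have h := ENNReal.Tendsto.const_mul (a := (B : ℝ≥0∞))
      (((tendsto_ofReal_div_natCast_mul (relayVar xth p (fun _ => 1)) (η ^ 2)).add
        (tendsto_ofReal_div_natCast_mul (relayVar xth p (stateEnt α σ)) (η ^ 2))).add
        ((ENNReal.Tendsto.const_mul (a := 3)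
          (tendsto_ofReal_div_natCast_mul chiSqVar (τ / 2 * (ε / 4) ^ 2))
          (Or.inr (by simp))).add (tendsto_ofReal_two_rpow_neg hc)))
      (Or.inr (ENNReal.natCast_ne_top B))
    simpa using h
  refine tendsto_of_tendsto_of_tendsto_of_le_of_le' tendsto_const_nhds hlim
    (Eventually.of_forall fun _ => zero_le) ?_
  have hev : ∀ᶠ k : ℕ in atTop, 1 ≤ (k : ℝ) * η :=
    (tendsto_natCast_atTop_atTop.atTop_mul_const hη).eventually_ge_atTop 1
  filter_upwards [hev] with k hk
  exact errorProb_le hα hσ hτ hε hη h1 h2 h3 (by rw [hcdef]; ring) B hk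

end FDRelay

end

theorem lemma2 (α σ PS xth : ℝ) (hα : 0 < α) (hσ : 0 < σ) (hPS : 0 < PS) (hxth : 0 < xth)
    (p : Measure ℝ) [IsProbabilityMeasure p]
    (hth : ∫ x, FDRelay.srcPower α xth x ∂p = PS) :
    (∀ x : ℝ, IsGreatest (FDRelay.infoValues α σ xth x)
      (ENNReal.ofReal (FDRelay.stateRate α σ xth x))) ∧
    ∫⁻ x, sSup (FDRelay.infoValues α σ xth x) ∂p =
      ENNReal.ofReal (∫ x, FDRelay.stateRate α σ xth x ∂p) ∧
    ∀ R : ℝ, R < ∫ x, FDRelay.stateRate α σ xth x ∂p →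
      ∃ ε₀ : ℝ, 0 < ε₀ ∧ ∀ ε : ℝ, 0 < ε → ε < ε₀ → ∀ B : ℕ,
        Tendsto (fun k : ℕ => FDRelay.errorProb α σ xth p R ε B k) atTop (𝓝 0) := by
  refine ⟨fun x => FDRelay.isGreatest_infoValues hα hσ xth x,
    FDRelay.lintegral_sSup_infoValues hα hσ xth p, fun R hR => ?_⟩
  have hτ : 0 < FDRelay.activeProb xth p := FDRelay.activeProb_pos hxth (hth ▸ hPS)
  rw [FDRelay.integral_stateRate_eq hα hσ hxth hτ] at hR
  -- The typicality margins cost `3 ε` of the information per active position.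
  refine ⟨(FDRelay.activeInfo α σ xth p - R / FDRelay.activeProb xth p) / 3, ?_,
    fun ε hε hε₀ B => FDRelay.tendsto_errorProb hα hσ hτ hε ?_ B⟩
  · have : R / FDRelay.activeProb xth p < FDRelay.activeInfo α σ xth p := by
      rwa [div_lt_iff₀ hτ, mul_comm]
    linarith
  · rw [← div_lt_iff₀' hτ]
    linarith
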